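/- Let $\mathcal V$ be a finite non-empty set, $N=|\mathcal V|$, $\theta^\star\in\mathbb R$, $0<\alpha<\beta$, $0<p<1$, and let $y_i=\theta^\star+\omega_i^\star\eta_i$ ($i\in\mathcal V$), where all the $\omega_i^\star$ and $\eta_i$ are independent, $\eta_i\sim\mathsf N(0,1)$, $\mathbb P(\omega^\star_i=\beta)=p$ and $\mathbb P(\omega^\star_i=\alpha)=1-p$. For $\theta\in\mathbb R$ and $\omega\in\{\alpha,\beta\}^{\mathcal V}$ let $$L_N(\theta,\omega)=\frac1N\log\prod_{i\in\mathcal V}\pi(\omega_i)\,\frac{1}{\omega_i\sqrt{2\pi}}\,e^{-\frac{(y_i-\theta)^2}{2\omega_i^2}},\qquad \pi(\alpha)=1-p,\quad \pi(\beta)=p,$$ be the rescaled log-likelihood, and let $$\widehat\theta(\omega)=\frac{\sum_j y_j\omega_j^{-2}}{\sum_j\omega_j^{-2}},\qquad \widehat\omega(\theta)_i=\begin{cases}\alpha&\text{if }|y_i-\theta|<\delta,\\ \beta&\text{otherwise,}\end{cases}\qquad \delta=\sqrt{\frac{2\ln\left(\frac{1-p}{p}\frac{\beta}{\alpha}\right)}{\frac1{\alpha^2}-\frac1{\beta^2}}}$$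 (with $\delta=0$ if the logarithm is negative). Let $\gamma^{(t)}$, $t=0,1,2,\dots$, be real numbers with $\gamma^{(t)}\to0$, $\gamma^{(t)}\ge 1/t$ for all sufficiently large $t$, and $\gamma^{(t)}=\gamma^{(t+1)}+o(\gamma^{(t+1)})$ as $t\to\infty$. Let $P\in\mathbb R^{\mathcal V\times\mathcal V}$ be a non-negative, stochastic, symmetric and primitive matrix (some power of $P$ has only positive entries), all of whose eigenvalues are positive. Starting from $\mu_i^{(0)}=\nu_i^{(0)}=0$, $\widehat\omega_i^{(0)}=\alpha$, the input-driven consensus algorithm computes, for $t\ge0$ and $i\in\mathcal V$, $$\mu_i^{(t+1)}=(1-\gamma^{(t)})\sum_jP_{ij}\mu_j^{(t)}+\gamma^{(t)}\frac{y_i}{(\widehat\omega_i^{(t)})^{2}},\qquad \nu_i^{(t+1)}=(1-\gamma^{(t)})\sum_jP_{ij}\nu_j^{(t)}+\gamma^{(t)}\frac{1}{(\widehat\omega_i^{(t)})^{2}},$$ $$\widehat\theta_i^{(t+1)}=\frac{\mu_i^{(t+1)}}{\nu_i^{(t+1)}},\qquad \widehat\omega_i^{(t+1)}=\begin{cases}\alpha&\text{if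 }|y_i-\widehat\theta_i^{(t+1)}|<\delta,\\ \beta&\text{otherwise}\end{cases}$$ (a quotient with denominator $0$, which can occur only at finitely many times, is read as $0$). Then there are random variables $\widehat\omega^{IA}$ with values in $\{\alpha,\beta\}^{\mathcal V}$ and $\widehat\theta^{IA}$ with values in $\mathbb R$ such that, almost surely: 1. all $\nu_i^{(t)}$ are positive for $t$ sufficiently large, $\lim_{t\to\infty}\widehat\omega^{(t)}=\widehat\omega^{IA}$, and $\lim_{t\to\infty}\widehat\theta_i^{(t)}=\widehat\theta^{IA}$ for all $i\in\mathcal V$; 2. $\widehat\theta^{IA}=\widehat\theta(\widehat\omega^{IA})$ and $\widehat\omega^{IA}=\widehat\omega(\widehat\theta^{IA})$; moreover $\widehat\theta^{IA}$ is the unique maximizer of $\theta\mapsto L_N(\theta,\widehat\omega^{IA})$ over $\mathbb R$, and $\widehat\omega^{IA}$ is a maximizer of $\omega\mapsto L_N(\widehat\theta^{IA},\omega)$ over $\{\alpha,\beta\}^{\mathcal V}$; 3. $\widehat\theta^{IA}$ is a local maximum of the function $\theta\mapsto L_N(\theta,\widehat\omega(\theta))$. -/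

import Mathlib

open MeasureTheory ProbabilityTheory Filter Topology Asymptotics

noncomputable section

namespace InputDrivenConsensus

/-- The observations `y_i = θ⋆ + ω⋆_i η_i`. -/
def observation {V Ω : Type*} (θstar : ℝ) (W η : V → Ω → ℝ) (x : Ω) (i : V) : ℝ :=
  θstar + W i x * η i x

/-- The conditional density of one observation: Gaussian with mean `θ` and standard deviation `s`,
`f(z | θ, s) = (1 / (s √(2π))) exp (-(z - θ)² / (2 s²))`. -/
def condDensity (θ s z : ℝ) : ℝ :=
  1 / (s * Real.sqrt (2 * Real.pi)) * Real.exp (-(z - θ) ^ 2 / (2 * s ^ 2))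

open Classical in
/-- The joint distribution `f(y, ω | θ)`, for `ω ∈ {α, β}^V`: a density in `y`, a probability
in `ω` (`ω_i = β` has probability `p`, `ω_i = α` has probability `1 - p`). -/
def jointDensity {V : Type*} [Fintype V] (α p : ℝ) (y : V → ℝ) (θ : ℝ) (ω : V → ℝ) : ℝ :=
  ∏ i, (if ω i = α then 1 - p else p) * condDensity θ (ω i) (y i)

/-- The rescaled log-likelihood `L_N(θ, ω) = (1/N) log f(y, ω | θ)`, with `N = |V|`. -/
def logLikelihood {V : Type*} [Fintype V] (α p : ℝ) (y : V → ℝ) (θ : ℝ) (ω : V → ℝ) : ℝ :=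
  1 / (Fintype.card V : ℝ) * Real.log (jointDensity α p y θ ω)

/-- The threshold `δ`. When the argument of the square root is negative, the classification
`β` is always the more likely one; the value `0` of `Real.sqrt` there gives exactly that in
`omegaHat`. -/
def delta (α β p : ℝ) : ℝ :=
  Real.sqrt (2 * Real.log ((1 - p) / p * (β / α)) / (1 / α ^ 2 - 1 / β ^ 2))

/-- `θ̂(ω) = (∑ y_j ω_j⁻²) / (∑ ω_j⁻²)`. -/
def thetaHat {V : Type*} [Fintype V] (y ω : V → ℝ) : ℝ :=
  (∑ j, y j / ω j ^ 2) / ∑ j, 1 / ω j ^ 2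

open Classical in
/-- The classification of one node with observation `z` and estimate `θ`. -/
def classify (α β p z θ : ℝ) : ℝ :=
  if |z - θ| < delta α β p then α else β

/-- `ω̂(θ)`. -/
def omegaHat {V : Type*} (α β p : ℝ) (y : V → ℝ) (θ : ℝ) : V → ℝ :=
  fun i => classify α β p (y i) θ

/-- The memory `(μ_i, ν_i, ω̂_i)` of all the nodes. -/
structure State (V : Type*) where
  mu : V → ℝ
  nu : V → ℝ
  omega : V → ℝ

/-- The estimates `θ̂_i = μ_i / ν_i`. -/
def State.theta {V : Type*} (s : State V) : V → ℝ :=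
  fun i => s.mu i / s.nu i

/-- The average step of one variable, with step size `g`, current value `z` and input `u`. -/
def averageStep {V : Type*} [Fintype V] (P : Matrix V V ℝ) (g : ℝ) (z u : V → ℝ) : V → ℝ :=
  fun i => (1 - g) * ∑ j, P i j * z j + g * u i

/-- The input-driven consensus algorithm with data `y`, started at `μ = ν = 0`, `ω̂ = α`. -/
def iterate {V : Type*} [Fintype V] (P : Matrix V V ℝ) (γ : ℕ → ℝ) (α β p : ℝ) (y : V → ℝ) :
    ℕ → State V
  | 0 => ⟨fun _ => 0, fun _ => 0, fun _ => α⟩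
  | t + 1 =>
    let s := iterate P γ α β p y t
    let mu' := averageStep P (γ t) s.mu (fun i => y i / s.omega i ^ 2)
    let nu' := averageStep P (γ t) s.nu (fun i => 1 / s.omega i ^ 2)
    ⟨mu', nu', fun i => classify α β p (y i) (mu' i / nu' i)⟩

end InputDrivenConsensus

end

/-! The heart of the matter is that each classification changes only finitely often. Once it is
frozen at `w`, the memories obey linear recursions with constant inputs: their means relax because
the steps are not summable, their components along eigenvalues below 1 are O(γ), and all quotients
tend to `thetaHat y w` (`tendsto_theta`). Almost surely no such value lies on a threshold, so the
classification is locally constant there. This gives the fixed point relation, and near the limit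
the profile likelihood coincides with the one for frozen `w`, which is quadratic in θ with its
maximum at `thetaHat y w`.

Freezing (`eventually_side`). Fix a threshold τ = y_i + σδ of node i, with σ = ±1. The deviation n =
σ(μ - τν) obeys the same recursion with inputs σ(y_j - τ)/ω_j², and the sign of n_i tells on which
side of τ the estimate of node i lies. Node i itself receives -δ/ω_i², which is larger on the side
n_i ≥ 0 (class β) than just below it (class α), so the feedback supports the present side. Along
infinitely many crossings n_i → 0, since increments vanish; by consensus all estimates, at every
fixed lag, tend to τ; and since thresholds of distinct nodes almost surely differ, the other nodes
are then classified as at τ. Hence recent inputs agree, off coordinate i, with a fixed vector, whose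
i-th entry is taken for class β or α. The β version has the larger mean, so either its mean is
positive, which excludes late downward crossings, or the mean of the α version is negative, which
excludes late upward ones.

The exclusion is `eventually_lt_succ`. Divided by γ, the mode of eigenvalue λ < 1 follows a
contraction with factor λ, with stationary value b/(1 - λ) for constant input b. A past input at
node i that is smaller than the reference one, k + 1 steps ago, acts on the i-th coordinate of this
mode through λ^k v(i)² ≥ 0; this is where positivity of the spectrum enters. So the modes are
bounded on one side by their stationary values, and the increment of n_i is at least γ times (mean
input - o(1)). -/

namespace InputDrivenConsensus

/-! ### Scalar recursions -/

/-- A relaxation step with non-summable weights and vanishing inputs has non-positive limsup. -/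
theorem eventually_le_of_relaxation {g x e : ℕ → ℝ} (hg : ∀ᶠ t in atTop, 0 ≤ g t ∧ g t ≤ 1)
    (hsum : Tendsto (fun n => ∑ t ∈ Finset.range n, g t) atTop atTop)
    (he : Tendsto e atTop (𝓝 0))
    (hx : ∀ᶠ t in atTop, x (t + 1) ≤ (1 - g t) * x t + g t * e t) {ε : ℝ} (hε : 0 < ε) :
    ∀ᶠ t in atTop, x t ≤ ε := by
  have he' : ∀ᶠ t in atTop, e t ≤ ε / 2 := he.eventually_le_const (by linarith)
  obtain ⟨T, hT⟩ := eventually_atTop.1 (hg.and (hx.and he'))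
  set M := max (x T - ε / 2) 0 with hM
  have hM0 : 0 ≤ M := le_max_right _ _
  -- The excess over ε/2 is multiplied by at most 1 - g ≤ exp(-g) at each step; the truncation at 0
  -- in `M` lets this bound apply to a negative excess too.
  have hbound : ∀ n, x (T + n) - ε / 2 ≤
      M * Real.exp (-(∑ t ∈ Finset.range (T + n), g t - ∑ t ∈ Finset.range T, g t)) := by
    intro n
    induction n with
    | zero => simp [hM]
    | succ n ih =>
      obtain ⟨⟨h0, h1⟩, h2, h3⟩ := hT (T + n) (by omega)
      rw [← add_assoc, Finset.sum_range_succ]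
      set S := ∑ t ∈ Finset.range (T + n), g t
      set S0 := ∑ t ∈ Finset.range T, g t
      have hexp : 1 - g (T + n) ≤ Real.exp (-(g (T + n))) := by
        have := Real.add_one_le_exp (-(g (T + n))); linarith
      have hE : 0 ≤ M * Real.exp (-(S - S0)) := by positivity
      calc x (T + n + 1) - ε / 2 ≤ (1 - g (T + n)) * (x (T + n) - ε / 2) := by
              nlinarith [mul_le_mul_of_nonneg_left h3 h0]
        _ ≤ (1 - g (T + n)) * (M * Real.exp (-(S - S0))) :=
              mul_le_mul_of_nonneg_left ih (by linarith)
        _ ≤ Real.exp (-(g (T + n))) * (M * Real.exp (-(S - S0))) :=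
              mul_le_mul_of_nonneg_right hexp hE
        _ = M * Real.exp (-(S + g (T + n) - S0)) := by
              rw [mul_left_comm, ← Real.exp_add]; congr 2; ring
  have hlim : Tendsto (fun n => M * Real.exp (-(∑ t ∈ Finset.range n, g t -
      ∑ t ∈ Finset.range T, g t))) atTop (𝓝 (M * 0)) :=
    (Real.tendsto_exp_neg_atTop_nhds_zero.comp
      (tendsto_atTop_add_const_right _ _ hsum)).const_mul M
  rw [mul_zero] at hlim
  filter_upwards [hlim.eventually_le_const (show (0 : ℝ) < ε / 2 by linarith),
    eventually_ge_atTop T] with t h1 h2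
  have := hbound (t - T)
  rw [Nat.add_sub_cancel' h2] at this
  linarith

theorem tendsto_zero_of_relaxation {g x e : ℕ → ℝ} (hg : ∀ᶠ t in atTop, 0 ≤ g t ∧ g t ≤ 1)
    (hsum : Tendsto (fun n => ∑ t ∈ Finset.range n, g t) atTop atTop)
    (he : Tendsto e atTop (𝓝 0))
    (hx : ∀ᶠ t in atTop, x (t + 1) = (1 - g t) * x t + g t * e t) :
    Tendsto x atTop (𝓝 0) := by
  rw [Metric.tendsto_nhds]
  intro ε hε
  have h1 := eventually_le_of_relaxation hg hsum he (hx.mono fun t h => h.le) (half_pos hε)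
  have h2 := eventually_le_of_relaxation (x := fun t => -x t) (e := fun t => -e t) hg hsum
    (by simpa using he.neg) (hx.mono fun t h => by rw [h]; linarith) (half_pos hε)
  filter_upwards [h1, h2] with t h1 h2
  rw [Real.dist_eq, sub_zero, abs_lt]
  constructor <;> linarith

/-- Admissible step sizes: positive, vanishing, slowly varying and not summable. -/
structure IsStepSize (γ : ℕ → ℝ) : Prop where
  tendsto_zero : Tendsto γ atTop (𝓝 0)
  pos : ∀ᶠ t in atTop, 0 < γ t
  ratio : Tendsto (fun t => γ t / γ (t + 1)) atTop (𝓝 1)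
  sum : Tendsto (fun n => ∑ t ∈ Finset.range n, γ t) atTop atTop

theorem isStepSize_of_le {γ : ℕ → ℝ} (hγ0 : Tendsto γ atTop (𝓝 0))
    (hγ1 : ∀ᶠ t : ℕ in atTop, 1 / (t : ℝ) ≤ γ t)
    (hγ2 : (fun t => γ t - γ (t + 1)) =o[atTop] fun t => γ (t + 1)) : IsStepSize γ := by
  have hpos : ∀ᶠ t in atTop, 0 < γ t := by
    filter_upwards [hγ1, eventually_gt_atTop 0] with t h1 h2
    have : (0 : ℝ) < 1 / t := by positivity
    linarith
  refine ⟨hγ0, hpos, ?_, ?_⟩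
  · have h := hγ2.tendsto_div_nhds_zero.add_const 1
    rw [zero_add] at h
    refine h.congr' ?_
    filter_upwards [(tendsto_add_atTop_nat 1).eventually hpos] with t ht
    have : γ (t + 1) ≠ 0 := ht.ne'
    field_simp
    ring
  · obtain ⟨T, hT⟩ := eventually_atTop.1 hγ1
    have hle : ∀ n, ∑ t ∈ Finset.range n, (1 / (t : ℝ)) +
        ∑ t ∈ Finset.range T, (-|γ t| - 1 / (t : ℝ)) ≤ ∑ t ∈ Finset.range n, γ t := by
      intro n
      -- The comparison with the harmonic series fails only for `t < T`; these finitely many terms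
      -- are absorbed in a constant independent of `n`.
      have key : ∀ t ∈ Finset.range n, (1 / (t : ℝ)) +
          (if t < T then (-|γ t| - 1 / (t : ℝ)) else 0) ≤ γ t := by
        intro t _
        split_ifs with h
        · linarith [neg_abs_le (γ t)]
        · simpa using hT t (by omega)
      have h := Finset.sum_le_sum key
      rw [Finset.sum_add_distrib] at h
      refine le_trans (add_le_add le_rfl ?_) h
      rw [← Finset.sum_filter, ← neg_le_neg_iff, ← Finset.sum_neg_distrib,
        ← Finset.sum_neg_distrib]
      refine Finset.sum_le_sum_of_subset_of_nonneg ?_ ?_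
      · intro t ht
        simp only [Finset.mem_filter, Finset.mem_range] at ht ⊢
        exact ht.2
      · intro t _ _
        have : (0 : ℝ) ≤ 1 / t := by positivity
        linarith [abs_nonneg (γ t)]
    exact tendsto_atTop_mono hle
      (tendsto_atTop_add_const_right _ _ ((not_summable_iff_tendsto_nat_atTop_of_nonneg fun n => by positivity).1
        Real.not_summable_one_div_natCast))

theorem IsStepSize.eventually_mem {γ : ℕ → ℝ} (h : IsStepSize γ) :
    ∀ᶠ t in atTop, 0 ≤ γ t ∧ γ t ≤ 1 := by
  filter_upwards [h.pos, h.tendsto_zero.eventually_le_const one_pos] with t h1 h2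
  exact ⟨h1.le, h2⟩

/-- A strictly contracting mode, driven by inputs of the order of the step size, stays of that
order. -/
theorem IsStepSize.scaled_bounded {γ W b : ℕ → ℝ} {lam B : ℝ} (h : IsStepSize γ) (h0 : 0 ≤ lam)
    (h1 : lam < 1) (hb : ∀ᶠ t in atTop, |b t| ≤ B)
    (hW : ∀ t, W (t + 1) = (1 - γ t) * (lam * W t) + γ t * b t) :
    ∃ C, ∀ᶠ t in atTop, |W t / γ t| ≤ C := by
  -- Dividing by γ turns the factor λ into γ(t)/γ(t+1)·(1 - γ(t))·λ, which tends to λ and is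
  -- eventually below this midpoint. The quantity 2B/(1 - λ') is the fixed point of x ↦ λ'x + 2B,
  -- the 2 bounding the step ratio.
  set lam' := (1 + lam) / 2 with hl
  have hl' : 0 < 1 - lam' := by rw [hl]; linarith
  have hlim : Tendsto (fun t => γ t / γ (t + 1) * ((1 - γ t) * lam)) atTop (𝓝 lam) := by
    have := h.ratio.mul (((h.tendsto_zero.const_sub 1)).mul_const lam)
    simpa using this
  have hB : 0 ≤ B := by
    obtain ⟨t, ht⟩ := hb.exists
    exact (abs_nonneg _).trans ht
  have hstep : ∀ᶠ t in atTop, |W (t + 1) / γ (t + 1)| - 2 * B / (1 - lam') ≤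
      (1 - (1 - lam')) * (|W t / γ t| - 2 * B / (1 - lam')) + (1 - lam') * 0 := by
    filter_upwards [h.eventually_mem, h.pos, (tendsto_add_atTop_nat 1).eventually h.pos, hb,
      h.ratio.eventually_le_const (show (1 : ℝ) < 2 by norm_num),
      hlim.eventually_le_const (show lam < lam' by rw [hl]; linarith)] with t hm hp hp' hbt hr hl2
    have hr0 : 0 ≤ γ t / γ (t + 1) := by positivity
    have heq : W (t + 1) / γ (t + 1) = γ t / γ (t + 1) * ((1 - γ t) * lam) * (W t / γ t) +
        γ t / γ (t + 1) * b t := by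
      rw [hW]; field_simp
    have hc0 : 0 ≤ γ t / γ (t + 1) * ((1 - γ t) * lam) :=
      mul_nonneg hr0 (mul_nonneg (by linarith) h0)
    have habs : |W (t + 1) / γ (t + 1)| ≤ lam' * |W t / γ t| + 2 * B := by
      rw [heq]
      refine (abs_add_le _ _).trans ?_
      rw [abs_mul, abs_mul (γ t / γ (t + 1)) (b t), abs_of_nonneg hc0, abs_of_nonneg hr0]
      exact add_le_add (mul_le_mul_of_nonneg_right hl2 (abs_nonneg _))
        (mul_le_mul hr hbt (abs_nonneg _) (by norm_num))
    have : 2 * B / (1 - lam') * (1 - lam') = 2 * B := by field_simp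
    nlinarith
  have hsum : Tendsto (fun n => ∑ t ∈ Finset.range n, (fun _ : ℕ => 1 - lam') t) atTop atTop := by
    simp only [Finset.sum_const, Finset.card_range, nsmul_eq_mul]
    exact tendsto_natCast_atTop_atTop.atTop_mul_const hl'
  have := eventually_le_of_relaxation (g := fun _ => 1 - lam') (e := fun _ => 0)
    (x := fun t => |W t / γ t| - 2 * B / (1 - lam'))
    (Eventually.of_forall fun _ => ⟨hl'.le, by rw [hl]; linarith⟩) hsum tendsto_const_nhds hstep
    one_pos
  exact ⟨1 + 2 * B / (1 - lam'), this.mono fun t ht => by linarith⟩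

/-- Because the scaled mode is bounded and the steps vary slowly, replacing both time-dependent
coefficients by their limits λ and 1 costs only o(1). -/
theorem IsStepSize.scaled_residual {γ W b : ℕ → ℝ} {lam B : ℝ} (h : IsStepSize γ) (h0 : 0 ≤ lam)
    (h1 : lam < 1) (hb : ∀ᶠ t in atTop, |b t| ≤ B)
    (hW : ∀ t, W (t + 1) = (1 - γ t) * (lam * W t) + γ t * b t) :
    Tendsto (fun t => W (t + 1) / γ (t + 1) - lam * (W t / γ t) - b t) atTop (𝓝 0) := by
  obtain ⟨C, hC⟩ := h.scaled_bounded h0 h1 hb hW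
  have hlim : Tendsto (fun t => |γ t / γ (t + 1) * (1 - γ t) - 1| * (lam * C) +
      |γ t / γ (t + 1) - 1| * B) atTop (𝓝 0) := by
    have e1 : Tendsto (fun t => γ t / γ (t + 1) * (1 - γ t) - 1) atTop (𝓝 0) := by
      simpa using (h.ratio.mul (h.tendsto_zero.const_sub 1)).sub_const 1
    have e2 : Tendsto (fun t => γ t / γ (t + 1) - 1) atTop (𝓝 0) := by
      simpa using h.ratio.sub_const 1
    simpa using (e1.abs.mul_const (lam * C)).add (e2.abs.mul_const B)
  refine squeeze_zero_norm' ?_ hlim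
  filter_upwards [hC, hb, h.pos, (tendsto_add_atTop_nat 1).eventually h.pos] with t hC hb hp hp'
  have heq : W (t + 1) / γ (t + 1) - lam * (W t / γ t) - b t =
      (γ t / γ (t + 1) * (1 - γ t) - 1) * (lam * (W t / γ t)) + (γ t / γ (t + 1) - 1) * b t := by
    rw [hW]; field_simp; ring
  rw [heq, Real.norm_eq_abs]
  refine (abs_add_le _ _).trans ?_
  rw [abs_mul, abs_mul _ (b t), abs_mul lam, abs_of_nonneg h0]
  gcongr

/-- A contraction inequality that holds at every fixed lag along `F` forces a non-positive
limsup along `F`. -/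
theorem eventually_le_of_contraction_lags {F : Filter ℕ} (hF : F ≤ atTop) {d e : ℕ → ℝ}
    {lam D : ℝ} (h0 : 0 ≤ lam) (h1 : lam < 1) (hd : ∀ᶠ t in atTop, d t ≤ D)
    (he : Tendsto e atTop (𝓝 0))
    (hstep : ∀ k : ℕ, ∀ᶠ t in F, d (t - k) ≤ lam * d (t - (k + 1)) + e (t - (k + 1)))
    {ε : ℝ} (hε : 0 < ε) : ∀ᶠ t in F, d t ≤ ε := by
  have hlag : ∀ k : ℕ, Tendsto (fun t : ℕ => t - k) F atTop := fun k =>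
    (tendsto_sub_atTop_nat k).mono_left hF
  have hiter : ∀ k : ℕ, ∀ ε > 0, ∀ᶠ t in F, d t ≤ lam ^ k * d (t - k) + ε := by
    intro k
    induction k with
    | zero => intro ε hε; simp [hε.le]
    | succ k ih =>
      intro ε hε
      filter_upwards [ih (ε / 2) (half_pos hε), hstep k,
        (he.comp (hlag (k + 1))).eventually_le_const (half_pos hε)] with t h2 h3 h4
      have hk : 0 ≤ lam ^ k := pow_nonneg h0 k
      have hk1 : lam ^ k ≤ 1 := pow_le_one₀ h0 h1.le
      simp only [Function.comp_apply] at h4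
      have : lam ^ k * d (t - k) ≤ lam ^ k * (lam * d (t - (k + 1)) + ε / 2) :=
        mul_le_mul_of_nonneg_left (by linarith) hk
      rw [pow_succ]
      nlinarith
  have hpow : Tendsto (fun k => lam ^ k * max D 0) atTop (𝓝 0) := by
    simpa using (tendsto_pow_atTop_nhds_zero_of_lt_one h0 h1).mul_const (max D 0)
  -- The number of lags is fixed before letting `t` run along `F`, so only finitely many of the
  -- eventual statements are intersected.
  obtain ⟨k, hk⟩ := (hpow.eventually_le_const (half_pos hε)).exists
  filter_upwards [hiter k (ε / 2) (half_pos hε), (hlag k).eventually hd] with t h2 h3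
  have : lam ^ k * d (t - k) ≤ lam ^ k * max D 0 :=
    mul_le_mul_of_nonneg_left (h3.trans (le_max_left _ _)) (pow_nonneg h0 k)
  linarith

/-! ### Spectral data of the consensus matrix -/

/-- The mean of a vector. -/
noncomputable def mean {V : Type*} [Fintype V] (m : V → ℝ) : ℝ :=
  (∑ i, m i) / (Fintype.card V : ℝ)

/-- An orthonormal eigenbasis `v` with eigenvalues `lam` in `(0, 1]`, the eigenvectors for `1`
spanning the constant vectors. -/
structure IsConsensusBasis {V : Type*} [Fintype V] (P : Matrix V V ℝ) (lam : V → ℝ)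
    (v : V → V → ℝ) : Prop where
  pos : ∀ l, 0 < lam l
  le_one : ∀ l, lam l ≤ 1
  left_eigen : ∀ l j, ∑ i, v l i * P i j = lam l * v l j
  expand : ∀ (m : V → ℝ) i, ∑ l, v l i * ∑ j, v l j * m j = m i
  expand_dev : ∀ (m : V → ℝ) i,
    ∑ l with lam l ≠ 1, v l i * ∑ j, v l j * m j = m i - mean m

section Spectral

variable {V : Type*} [Fintype V] [DecidableEq V] [Nonempty V] {P : Matrix V V ℝ}

theorem eigenvalue_le_one_of_rowStochastic (hP : P ∈ Matrix.rowStochastic ℝ V) {lam : ℝ}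
    {x : V → ℝ} (hx : x ≠ 0) (h : P.mulVec x = lam • x) : lam ≤ 1 := by
  obtain ⟨i, hi⟩ := Finite.exists_max fun i => |x i|
  have hpos : 0 < |x i| := by
    obtain ⟨j, hj⟩ := Function.ne_iff.1 hx
    exact (abs_pos.2 hj).trans_le (hi j)
  have h1 : lam * x i = ∑ j, P i j * x j := (congrFun h i).symm
  have h2 : |lam * x i| ≤ |x i| := by
    rw [h1]
    calc |∑ j, P i j * x j| ≤ ∑ j, |P i j * x j| := Finset.abs_sum_le_sum_abs _ _
      _ ≤ ∑ j, P i j * |x i| := by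
          refine Finset.sum_le_sum fun j _ => ?_
          rw [abs_mul, abs_of_nonneg (Matrix.nonneg_of_mem_rowStochastic hP)]
          exact mul_le_mul_of_nonneg_left (hi j) (Matrix.nonneg_of_mem_rowStochastic hP)
      _ = |x i| := by rw [← Finset.sum_mul, Matrix.sum_row_of_mem_rowStochastic hP, one_mul]
  rw [abs_mul] at h2
  have : |lam| ≤ 1 := by
    by_contra hlt
    nlinarith [not_le.1 hlt]
  exact (le_abs_self _).trans this

/-- Maximum principle for a positive power of `P`: the maximum of `x` is an average of all entries
with positive weights, so every entry attains it. -/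
theorem eq_of_fixed_of_isPrimitive (hP : P ∈ Matrix.rowStochastic ℝ V) (hprim : P.IsPrimitive)
    {x : V → ℝ} (h : P.mulVec x = x) (i j : V) : x i = x j := by
  obtain ⟨k, -, hk⟩ := hprim.exists_pos_pow
  have hfix : (P ^ k).mulVec x = x := by
    clear hk
    induction k with
    | zero => simp
    | succ k ih => rw [pow_succ, ← Matrix.mulVec_mulVec, h, ih]
  have hQ : P ^ k ∈ Matrix.rowStochastic ℝ V := pow_mem hP k
  obtain ⟨a, ha⟩ := Finite.exists_max x
  have hall : ∀ b, x b = x a := by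
    have hzero : ∑ b, (P ^ k) a b * (x a - x b) = 0 := by
      have h1 : ∑ b, (P ^ k) a b * x b = x a := congrFun hfix a
      simp only [mul_sub, Finset.sum_sub_distrib]
      rw [← Finset.sum_mul, Matrix.sum_row_of_mem_rowStochastic hQ, h1]
      ring
    rw [Finset.sum_eq_zero_iff_of_nonneg
      (fun b _ => mul_nonneg (hk a b).le (sub_nonneg.2 (ha b)))] at hzero
    intro b
    have := (mul_eq_zero.1 (hzero b (Finset.mem_univ b))).resolve_left (hk a b).ne'
    linarith
  rw [hall i, hall j]

theorem exists_isConsensusBasis (hP : P ∈ Matrix.rowStochastic ℝ V) (hsymm : P.IsSymm)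
    (hprim : P.IsPrimitive)
    (heig : ∀ l : ℝ, Module.End.HasEigenvalue (Matrix.toLin' P) l → 0 < l) :
    ∃ (lam : V → ℝ) (v : V → V → ℝ), IsConsensusBasis P lam v := by
  have hA : P.IsHermitian := by
    rw [Matrix.IsHermitian, Matrix.conjTranspose_eq_transpose_of_trivial]
    exact hsymm
  set b := hA.eigenvectorBasis with hb
  set lam := hA.eigenvalues with hlam
  have heq : ∀ l, P.mulVec (b l) = lam l • (b l : V → ℝ) := hA.mulVec_eigenvectorBasis
  have hne : ∀ l, (b l : V → ℝ) ≠ 0 := by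
    intro l h0
    have h1 : b l = 0 := by
      ext i
      exact congrFun h0 i
    have h2 := b.orthonormal.1 l
    rw [h1, norm_zero] at h2
    exact zero_ne_one h2
  have hle : ∀ l, lam l ≤ 1 := fun l => eigenvalue_le_one_of_rowStochastic hP (hne l) (heq l)
  have hleft : ∀ l j, ∑ i, b l i * P i j = lam l * b l j := by
    intro l j
    have h := congrFun (heq l) j
    rw [Pi.smul_apply, smul_eq_mul] at h
    rw [← h]
    exact Finset.sum_congr rfl fun i _ => by rw [mul_comm, ← hsymm.apply i j]
  have hexp : ∀ (m : V → ℝ) i, ∑ l, b l i * ∑ j, b l j * m j = m i := by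
    intro m i
    have h := congrArg (fun x : EuclideanSpace ℝ V => x i) (b.sum_repr' (WithLp.toLp 2 m))
    simp only [PiLp.inner_apply, RCLike.inner_apply, conj_trivial, WithLp.ofLp_sum,
      WithLp.ofLp_smul, Finset.sum_apply, Pi.smul_apply, smul_eq_mul] at h
    rw [← h]
    exact Finset.sum_congr rfl fun l _ => by
      rw [mul_comm]; congr 1; exact Finset.sum_congr rfl fun j _ => mul_comm _ _
  have hcard : (0 : ℝ) < Fintype.card V := by exact_mod_cast Fintype.card_pos
  have hconst : ∀ l, lam l = 1 → ∀ i j, b l i = b l j := fun l hl i j =>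
    eq_of_fixed_of_isPrimitive hP hprim (by rw [heq l, hl, one_smul]) i j
  have horth : ∀ l, lam l ≠ 1 → ∑ j, b l j = 0 := by
    intro l hl
    have h1 : ∑ j, ∑ i, b l i * P i j = ∑ j, b l j := by
      rw [Finset.sum_comm]
      exact Finset.sum_congr rfl fun i _ => by
        rw [← Finset.mul_sum, Matrix.sum_row_of_mem_rowStochastic hP, mul_one]
    simp only [hleft] at h1
    rw [← Finset.mul_sum] at h1
    have h2 : (lam l - 1) * ∑ j, b l j = 0 := by linarith
    exact (mul_eq_zero.1 h2).resolve_left (sub_ne_zero.2 hl)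
  -- Expanding the constant vector 1 in the basis normalizes the projection onto constants, without
  -- first proving that the eigenvalue 1 is simple.
  have hsum1 : ∀ i, ∑ l with lam l = 1, b l i * (b l i * Fintype.card V) = 1 := by
    intro i
    have h := hexp (fun _ => 1) i
    rw [← Finset.sum_filter_add_sum_filter_not Finset.univ (fun l => lam l = 1)] at h
    have h2 : ∑ l with ¬ lam l = 1, b l i * ∑ j, b l j * (1 : ℝ) = 0 := by
      refine Finset.sum_eq_zero fun l hl => ?_
      simp only [Finset.mem_filter, Finset.mem_univ, true_and] at hl
      simp [horth l hl]
    rw [h2, add_zero] at h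
    refine Eq.trans (Finset.sum_congr rfl fun l hl => ?_) h
    simp only [Finset.mem_filter, Finset.mem_univ, true_and] at hl
    congr 1
    rw [Finset.sum_congr rfl fun j _ => by rw [mul_one, hconst l hl j i]]
    simp [mul_comm]
  have hproj : ∀ (m : V → ℝ) i, ∑ l with lam l = 1, b l i * ∑ j, b l j * m j = mean m := by
    intro m i
    have h : ∀ l ∈ Finset.univ.filter (fun l => lam l = 1), b l i * ∑ j, b l j * m j =
        b l i * (b l i * Fintype.card V) * mean m := by
      intro l hl
      simp only [Finset.mem_filter, Finset.mem_univ, true_and] at hl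
      rw [Finset.sum_congr rfl fun j _ => by rw [hconst l hl j i], ← Finset.mul_sum, mean]
      field_simp
    rw [Finset.sum_congr rfl h, ← Finset.sum_mul, hsum1, one_mul]
  refine ⟨lam, fun l i => b l i, ?_, hle, hleft, hexp, ?_⟩
  · intro l
    refine heig _ (Module.End.hasEigenvalue_of_hasEigenvector
      (Module.End.hasEigenvector_iff.2 ⟨?_, hne l⟩))
    rw [Module.End.mem_eigenspace_iff, Matrix.toLin'_apply]
    exact heq l
  · intro m i
    rw [eq_sub_iff_add_eq, ← hproj m i, add_comm, ← hexp m i]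
    exact Finset.sum_filter_add_sum_filter_not Finset.univ (fun l => lam l = 1) _

end Spectral

/-! ### The linear input-driven consensus recursion -/

section Linear

variable {V : Type*} [Fintype V] {P : Matrix V V ℝ} {lam : V → ℝ} {v : V → V → ℝ} {γ : ℕ → ℝ}
  {m r : ℕ → V → ℝ} {B : ℝ}

theorem mean_averageStep (hcol : ∀ j, ∑ i, P i j = 1) (g : ℝ) (z u : V → ℝ) :
    mean (averageStep P g z u) = (1 - g) * mean z + g * mean u := by
  have h : ∑ i, ∑ j, P i j * z j = ∑ j, z j := by
    rw [Finset.sum_comm]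
    exact Finset.sum_congr rfl fun j _ => by rw [← Finset.sum_mul, hcol, one_mul]
  simp only [mean, averageStep, Finset.sum_add_distrib, ← Finset.mul_sum, h]
  ring

theorem mode_averageStep (hv : IsConsensusBasis P lam v) (l : V) (g : ℝ) (z u : V → ℝ) :
    ∑ i, v l i * averageStep P g z u i =
      (1 - g) * (lam l * ∑ i, v l i * z i) + g * ∑ i, v l i * u i := by
  have h : ∑ i, v l i * ∑ j, P i j * z j = lam l * ∑ j, v l j * z j := by
    simp only [Finset.mul_sum]
    rw [Finset.sum_comm]
    refine Finset.sum_congr rfl fun j _ => ?_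
    rw [← mul_assoc, ← hv.left_eigen l j, Finset.sum_mul]
    exact Finset.sum_congr rfl fun i _ => by ring
  rw [← h, Finset.mul_sum, Finset.mul_sum, ← Finset.sum_add_distrib]
  exact Finset.sum_congr rfl fun i _ => by rw [averageStep]; ring

theorem mode_input_bounded (hr : ∀ᶠ t in atTop, ∀ j, |r t j| ≤ B) (l : V) :
    ∀ᶠ t in atTop, |∑ j, v l j * r t j| ≤ ∑ j, |v l j| * B := by
  filter_upwards [hr] with t ht
  refine (Finset.abs_sum_le_sum_abs _ _).trans (Finset.sum_le_sum fun j _ => ?_)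
  rw [abs_mul]
  exact mul_le_mul_of_nonneg_left (ht j) (abs_nonneg _)

/-- The nodes agree asymptotically. -/
theorem tendsto_sub_mean (hv : IsConsensusBasis P lam v) (hγ : IsStepSize γ)
    (hm : ∀ t, m (t + 1) = averageStep P (γ t) (m t) (r t))
    (hr : ∀ᶠ t in atTop, ∀ j, |r t j| ≤ B) (i : V) :
    Tendsto (fun t => m t i - mean (m t)) atTop (𝓝 0) := by
  simp only [← hv.expand_dev]
  rw [← Finset.sum_const_zero (s := Finset.univ.filter fun l => lam l ≠ 1)]
  refine tendsto_finsetSum _ fun l hl => ?_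
  simp only [Finset.mem_filter, Finset.mem_univ, true_and] at hl
  obtain ⟨C, hC⟩ := hγ.scaled_bounded (W := fun t => ∑ j, v l j * m t j)
    (b := fun t => ∑ j, v l j * r t j) (hv.pos l).le (lt_of_le_of_ne (hv.le_one l) hl)
    (mode_input_bounded hr l) (fun t => by rw [hm, mode_averageStep hv])
  have hW : Tendsto (fun t => ∑ j, v l j * m t j) atTop (𝓝 0) := by
    refine squeeze_zero_norm' (a := fun t => C * γ t) ?_ (by simpa using hγ.tendsto_zero.const_mul C)
    filter_upwards [hC, hγ.pos] with t h1 h2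
    rwa [abs_div, abs_of_pos h2, div_le_iff₀ h2] at h1
  simpa using hW.const_mul (v l i)

theorem mean_bounded [Nonempty V] (hcol : ∀ j, ∑ i, P i j = 1) (hγ : IsStepSize γ)
    (hm : ∀ t, m (t + 1) = averageStep P (γ t) (m t) (r t))
    (hr : ∀ᶠ t in atTop, ∀ j, r t j ≤ B) {ε : ℝ} (hε : 0 < ε) :
    ∀ᶠ t in atTop, mean (m t) ≤ B + ε := by
  have hcard : (0 : ℝ) < Fintype.card V := by exact_mod_cast Fintype.card_pos
  have h := eventually_le_of_relaxation (x := fun t => mean (m t) - B) (e := fun _ => 0)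
    hγ.eventually_mem hγ.sum tendsto_const_nhds (by
      filter_upwards [hr, hγ.eventually_mem] with t ht hg
      have hB : mean (r t) ≤ B := by
        rw [mean, div_le_iff₀ hcard]
        refine (Finset.sum_le_card_nsmul _ _ B fun j _ => ht j).trans ?_
        simp [mul_comm]
      rw [hm, mean_averageStep hcol]
      nlinarith [mul_le_mul_of_nonneg_left hB hg.1]) hε
  exact h.mono fun t ht => by linarith

/-- The mean moves by γ times a bounded quantity, and each node is within o(1) of the mean at both
times. -/
theorem tendsto_increment [Nonempty V] (hv : IsConsensusBasis P lam v)
    (hcol : ∀ j, ∑ i, P i j = 1) (hγ : IsStepSize γ)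
    (hm : ∀ t, m (t + 1) = averageStep P (γ t) (m t) (r t))
    (hr : ∀ᶠ t in atTop, ∀ j, |r t j| ≤ B) (i : V) :
    Tendsto (fun t => m (t + 1) i - m t i) atTop (𝓝 0) := by
  have hcard : (0 : ℝ) < Fintype.card V := by exact_mod_cast Fintype.card_pos
  have hmean : Tendsto (fun t => mean (m (t + 1)) - mean (m t)) atTop (𝓝 0) := by
    have h1 := mean_bounded hcol hγ hm (hr.mono fun t h j => (abs_le.1 (h j)).2) one_pos
    have h2 := mean_bounded (m := fun t => -m t) (r := fun t => -r t) hcol hγ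
      (fun t => by
        rw [hm]; ext i; simp [averageStep]; ring)
      (hr.mono fun t h j => show -r t j ≤ B by linarith [(abs_le.1 (h j)).1]) one_pos
    refine squeeze_zero_norm' (a := fun t => γ t * (2 * B + 1)) ?_
      (by simpa using hγ.tendsto_zero.mul_const (2 * B + 1))
    filter_upwards [h1, h2, hr, hγ.pos] with t h1 h2 h3 h4
    have hneg : mean (-m t) = -mean (m t) := by simp [mean, neg_div]
    rw [hneg] at h2
    have hB : |mean (r t)| ≤ B := by
      rw [mean, abs_div, abs_of_pos hcard, div_le_iff₀ hcard]
      refine (Finset.abs_sum_le_sum_abs _ _).trans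
        ((Finset.sum_le_card_nsmul _ _ B fun j _ => h3 j).trans ?_)
      simp [mul_comm]
    have : mean (m (t + 1)) - mean (m t) = γ t * (mean (r t) - mean (m t)) := by
      rw [hm, mean_averageStep hcol]; ring
    rw [this, Real.norm_eq_abs, abs_mul, abs_of_pos h4]
    refine mul_le_mul_of_nonneg_left ?_ h4.le
    rw [abs_le] at hB ⊢
    constructor <;> linarith [hB.1, hB.2]
  have h := tendsto_sub_mean hv hγ hm hr i
  have h' := h.comp (tendsto_add_atTop_nat 1)
  have := (h'.sub h).add hmean
  simp only [sub_zero, add_zero] at this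
  exact this.congr fun t => by simp only [Function.comp_apply]; ring

/-- Along a filter on which node `i` has a vanishing value and has only received inputs bounded by
those of a fixed vector `rs` of positive mean, the value of node `i` increases. -/
theorem eventually_lt_succ (hv : IsConsensusBasis P lam v) (hγ : IsStepSize γ)
    (hm : ∀ t, m (t + 1) = averageStep P (γ t) (m t) (r t))
    (hr : ∀ᶠ t in atTop, ∀ j, |r t j| ≤ B) {F : Filter ℕ} (hF : F ≤ atTop) {rs : V → ℝ}
    (hrs : 0 < mean rs) {i : V} (hi : Tendsto (fun t => m t i) F (𝓝 0))
    (hri : ∀ᶠ t in F, r t i = rs i) (hle : ∀ k : ℕ, ∀ᶠ t in F, r (t - k) i ≤ rs i)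
    (hother : ∀ k : ℕ, ∀ᶠ t in F, ∀ j, j ≠ i → r (t - k) j = rs j) :
    ∀ᶠ t in F, m t i < m (t + 1) i := by
  set W : V → ℕ → ℝ := fun l t => ∑ j, v l j * m t j with hWdef
  set b : V → ℕ → ℝ := fun l t => ∑ j, v l j * r t j with hbdef
  set bs : V → ℝ := fun l => ∑ j, v l j * rs j with hbsdef
  -- The factor 1 - λ normalizes the scaled mode so that its stationary value is the input mode `bs
  -- l` itself.
  set w : V → ℕ → ℝ := fun l t => (1 - lam l) * (W l t / γ t) with hwdef
  have hW : ∀ l t, W l (t + 1) = (1 - γ t) * (lam l * W l t) + γ t * b l t := fun l t => by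
    rw [hWdef, hbdef]; simp only; rw [hm, mode_averageStep hv]
  have hbd : ∀ l, lam l ≠ 1 → ∃ C, ∀ᶠ t in atTop, |W l t / γ t| ≤ C := fun l hl =>
    hγ.scaled_bounded (hv.pos l).le (lt_of_le_of_ne (hv.le_one l) hl) (mode_input_bounded hr l)
      (hW l)
  -- each contracting mode is asymptotically dominated by its stationary value
  have hdom : ∀ l, lam l ≠ 1 → ∀ ε > 0, ∀ᶠ t in F, v l i * (w l t - bs l) ≤ ε := by
    intro l hl ε hε
    have hl1 : lam l < 1 := lt_of_le_of_ne (hv.le_one l) hl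
    obtain ⟨C, hC⟩ := hbd l hl
    have hres := hγ.scaled_residual (hv.pos l).le hl1 (mode_input_bounded hr l) (hW l)
    refine eventually_le_of_contraction_lags (D := |v l i| * ((1 - lam l) * C + |bs l|)) hF
      (hv.pos l).le hl1 ?_
      (e := fun t => v l i * ((1 - lam l) * (W l (t + 1) / γ (t + 1) - lam l * (W l t / γ t) -
        b l t))) ?_ ?_ hε
    · filter_upwards [hC] with t ht
      refine (le_abs_self _).trans ?_
      rw [abs_mul]
      refine mul_le_mul_of_nonneg_left ((abs_sub _ _).trans ?_) (abs_nonneg _)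
      rw [hwdef]
      simp only
      rw [abs_mul, abs_of_pos (sub_pos.2 hl1)]
      gcongr
    · simpa using (hres.const_mul (1 - lam l)).const_mul (v l i)
    · intro k
      filter_upwards [hF (eventually_ge_atTop (k + 1)), hle (k + 1), hother (k + 1)]
        with t htk h1 h2
      have hs : t - k = t - (k + 1) + 1 := by omega
      rw [hs]
      set s := t - (k + 1)
      -- The inputs differ only at `i`, so a second factor `v l i` makes a square: the sign of the
      -- error does not depend on the mode.
      have hbb : bs l - b l s = v l i * (rs i - r s i) := by
        rw [hbsdef, hbdef]
        simp only
        rw [← Finset.sum_sub_distrib, Finset.sum_eq_single i]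
        · ring
        · intro j _ hj
          rw [h2 j hj]; ring
        · simp
      have hnn : 0 ≤ v l i * (bs l - b l s) := by
        rw [hbb, ← mul_assoc]
        exact mul_nonneg (mul_self_nonneg _) (by linarith)
      have : 0 ≤ (1 - lam l) * (v l i * (bs l - b l s)) := mul_nonneg (by linarith) hnn
      rw [hwdef]
      simp only
      nlinarith
  have hsumdom : ∀ ε > 0, ∀ᶠ t in F,
      ∑ l with lam l ≠ 1, v l i * w l t ≤ rs i - mean rs + ε := by
    intro ε hε
    set N : ℝ := (Finset.univ.filter fun l => lam l ≠ 1).card + 1 with hN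
    have hNpos : 0 < N := by positivity
    have hall : ∀ᶠ t in F, ∀ l, lam l ≠ 1 → v l i * (w l t - bs l) ≤ ε / N := by
      rw [eventually_all]
      intro l
      by_cases hl : lam l = 1
      · simp [hl]
      · filter_upwards [hdom l hl (ε / N) (by positivity)] with t ht _
        exact ht
    filter_upwards [hall] with t ht
    have h1 : ∑ l with lam l ≠ 1, v l i * (w l t - bs l) ≤ ε := by
      refine (Finset.sum_le_card_nsmul _ _ (ε / N) fun l hl => ht l ?_).trans ?_
      · simpa using hl
      · rw [nsmul_eq_mul, mul_div_assoc', div_le_iff₀ hNpos, hN]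
        nlinarith
    -- The stationary values add up to the deviation of `rs i` from the mean; this is how the mean
    -- of `rs` enters.
    have h2 := hv.expand_dev rs i
    simp only [mul_sub, Finset.sum_sub_distrib] at h1
    linarith
  -- the increment in terms of the scaled modes
  have hdev : ∀ t, 0 < γ t → m t i - ∑ j, P i j * m t j =
      γ t * ∑ l with lam l ≠ 1, v l i * w l t := by
    intro t ht
    have h1 := hv.expand (m t) i
    have h2 := hv.expand (fun i => ∑ j, P i j * m t j) i
    have h3 : ∀ l, ∑ j, v l j * ∑ k, P j k * m t k = lam l * W l t := by
      intro l
      have := mode_averageStep hv l 0 (m t) 0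
      simpa [averageStep] using this
    simp only [h3] at h2
    rw [← h1, ← h2, ← Finset.sum_sub_distrib, Finset.mul_sum, Finset.sum_filter]
    refine Finset.sum_congr rfl fun l _ => ?_
    split_ifs with hl
    · rw [hwdef]; simp only; field_simp; ring
    · rw [not_not] at hl
      rw [hl]; simp [hWdef]
  have hwbd : ∃ C, ∀ᶠ t in atTop, |∑ l with lam l ≠ 1, v l i * w l t| ≤ C := by
    have : ∀ l, ∃ C, lam l ≠ 1 → ∀ᶠ t in atTop, |W l t / γ t| ≤ C := by
      intro l
      by_cases hl : lam l = 1
      · exact ⟨0, fun h => absurd hl h⟩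
      · obtain ⟨C, hC⟩ := hbd l hl
        exact ⟨C, fun _ => hC⟩
    choose C hC using this
    refine ⟨∑ l with lam l ≠ 1, |v l i| * (|1 - lam l| * C l), ?_⟩
    have hall : ∀ᶠ t in atTop, ∀ l, lam l ≠ 1 → |W l t / γ t| ≤ C l := by
      rw [eventually_all]
      intro l
      by_cases hl : lam l = 1
      · simp [hl]
      · exact (hC l hl).mono fun t ht _ => ht
    filter_upwards [hall] with t ht
    refine (Finset.abs_sum_le_sum_abs _ _).trans (Finset.sum_le_sum fun l hl => ?_)
    rw [hwdef]
    simp only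
    rw [abs_mul, abs_mul]
    have := ht l (by simpa using hl)
    gcongr
  obtain ⟨C, hC⟩ := hwbd
  have hPm : Tendsto (fun t => ∑ j, P i j * m t j) F (𝓝 0) := by
    have h1 : Tendsto (fun t => m t i - ∑ j, P i j * m t j) atTop (𝓝 0) := by
      refine squeeze_zero_norm' (a := fun t => γ t * C) ?_
        (by simpa using hγ.tendsto_zero.mul_const C)
      filter_upwards [hC, hγ.pos] with t h1 h2
      rw [hdev t h2, Real.norm_eq_abs, abs_mul, abs_of_pos h2]
      exact mul_le_mul_of_nonneg_left h1 h2.le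
    simpa using hi.sub (h1.mono_left hF)
  -- The modes and the averaged value each cost at most a third of `mean rs`, leaving an increment
  -- of at least γ · `mean rs` / 3.
  filter_upwards [hF hγ.pos, hsumdom (mean rs / 3) (by positivity), hri,
    hPm.eventually_le_const (show 0 < mean rs / 3 by positivity)] with t h1 h2 h3 h4
  have h5 := hdev t h1
  have h6 : m (t + 1) i = (1 - γ t) * ∑ j, P i j * m t j + γ t * r t i := by
    rw [hm]; rfl
  have h7 : m (t + 1) i - m t i = γ t * (rs i - ∑ j, P i j * m t j -
      ∑ l with lam l ≠ 1, v l i * w l t) := by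
    rw [h6, h3]; linarith
  have h8 : 0 < γ t * (rs i - ∑ j, P i j * m t j - ∑ l with lam l ≠ 1, v l i * w l t) :=
    mul_pos h1 (by linarith)
  linarith

end Linear

/-! ### Classification -/

theorem classify_mem (α β p z θ : ℝ) :
    classify α β p z θ = α ∨ classify α β p z θ = β := by
  unfold classify
  split_ifs <;> simp

theorem delta_nonneg (α β p : ℝ) : 0 ≤ delta α β p := Real.sqrt_nonneg _

theorem classify_of_delta_eq_zero {α β p : ℝ} (h : delta α β p = 0) (z θ : ℝ) :
    classify α β p z θ = β := by
  rw [classify, h, if_neg (not_lt.2 (abs_nonneg _))]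

theorem eventually_classify_eq {α β p z τ : ℝ} (h : 0 < delta α β p → |z - τ| ≠ delta α β p) :
    ∀ᶠ θ in 𝓝 τ, classify α β p z θ = classify α β p z τ := by
  rcases (delta_nonneg α β p).eq_or_lt with h0 | h0
  · exact Eventually.of_forall fun θ => by simp only [classify_of_delta_eq_zero h0.symm]
  · have hc : Tendsto (fun θ : ℝ => |z - θ|) (𝓝 τ) (𝓝 |z - τ|) :=
      (continuous_const.sub continuous_id).abs.tendsto τ
    rcases lt_or_gt_of_ne (h h0) with hlt | hgt
    · filter_upwards [hc.eventually_lt_const hlt] with θ hθ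
      rw [classify, classify, if_pos hθ, if_pos hlt]
    · filter_upwards [hc.eventually_const_lt hgt] with θ hθ
      rw [classify, classify, if_neg hθ.not_gt, if_neg hgt.not_gt]

theorem eventually_or_eventually_not {q : ℕ → Prop} (h : ∀ᶠ t in atTop, q t → q (t + 1)) :
    (∀ᶠ t in atTop, q t) ∨ ∀ᶠ t in atTop, ¬ q t := by
  obtain ⟨T, hT⟩ := eventually_atTop.1 h
  by_cases hq : ∃ t ≥ T, q t
  · obtain ⟨t, ht, hqt⟩ := hq
    refine Or.inl (eventually_atTop.2 ⟨t, fun u hu => ?_⟩)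
    induction u, hu using Nat.le_induction with
    | base => exact hqt
    | succ u hu ih => exact hT u (ht.trans hu) ih
  · push Not at hq
    exact Or.inr (eventually_atTop.2 ⟨T, hq⟩)

/-! ### The algorithm -/

section Algorithm

variable {V : Type*} [Fintype V] {P : Matrix V V ℝ} {γ : ℕ → ℝ} {α β p : ℝ} {y : V → ℝ}

theorem iterate_omega_mem (t : ℕ) (i : V) :
    (iterate P γ α β p y t).omega i = α ∨ (iterate P γ α β p y t).omega i = β := by
  cases t with
  | zero => exact Or.inl rfl
  | succ t => exact classify_mem ..

theorem iterate_omega_eq {t : ℕ} (ht : 0 < t) (i : V) :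
    (iterate P γ α β p y t).omega i =
      classify α β p (y i) ((iterate P γ α β p y t).theta i) := by
  obtain ⟨t, rfl⟩ := Nat.exists_eq_succ_of_ne_zero ht.ne'
  rfl

/-- The signed deviation `σ (μ - τ ν)` of the memory from the level `τ`. -/
noncomputable def deviation (P : Matrix V V ℝ) (γ : ℕ → ℝ) (α β p : ℝ) (y : V → ℝ) (σ τ : ℝ)
    (t : ℕ) (i : V) : ℝ :=
  σ * ((iterate P γ α β p y t).mu i - τ * (iterate P γ α β p y t).nu i)

/-- The input that drives `deviation`. -/
noncomputable def deviationInput (P : Matrix V V ℝ) (γ : ℕ → ℝ) (α β p : ℝ) (y : V → ℝ)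
    (σ τ : ℝ) (t : ℕ) (i : V) : ℝ :=
  σ * (y i - τ) / (iterate P γ α β p y t).omega i ^ 2

theorem deviation_succ (σ τ : ℝ) (t : ℕ) :
    deviation P γ α β p y σ τ (t + 1) =
      averageStep P (γ t) (deviation P γ α β p y σ τ t) (deviationInput P γ α β p y σ τ t) := by
  ext i
  simp only [deviation, deviationInput, iterate, averageStep, mul_sub, Finset.sum_sub_distrib]
  have h1 : ∀ f : V → ℝ, ∑ j, P i j * (σ * f j) = σ * ∑ j, P i j * f j := fun f => by
    rw [Finset.mul_sum]; exact Finset.sum_congr rfl fun j _ => by ring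
  have h2 : ∀ f : V → ℝ, ∑ j, P i j * (σ * (τ * f j)) = σ * (τ * ∑ j, P i j * f j) := fun f => by
    rw [Finset.mul_sum, Finset.mul_sum]; exact Finset.sum_congr rfl fun j _ => by ring
  rw [h1, h2]
  ring

theorem nu_succ (t : ℕ) :
    (iterate P γ α β p y (t + 1)).nu = averageStep P (γ t) (iterate P γ α β p y t).nu
      (fun i => 1 / (iterate P γ α β p y t).omega i ^ 2) := rfl

theorem inv_sq_omega_bounds (hα : 0 < α) (hαβ : α < β) (t : ℕ) (i : V) :
    1 / β ^ 2 ≤ 1 / (iterate P γ α β p y t).omega i ^ 2 ∧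
      1 / (iterate P γ α β p y t).omega i ^ 2 ≤ 1 / α ^ 2 := by
  have hβ := hα.trans hαβ
  have h : 1 / β ^ 2 ≤ 1 / α ^ 2 := by gcongr
  rcases iterate_omega_mem (P := P) (γ := γ) (α := α) (β := β) (p := p) (y := y) t i with h' | h'
  all_goals rw [h']
  · exact ⟨h, le_rfl⟩
  · exact ⟨le_rfl, h⟩

theorem deviationInput_bounded (hα : 0 < α) (hαβ : α < β) (σ τ : ℝ) :
    ∃ B, ∀ t j, |deviationInput P γ α β p y σ τ t j| ≤ B := by
  refine ⟨∑ i, |σ * (y i - τ)| * (1 / α ^ 2), fun t j => ?_⟩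
  have h := inv_sq_omega_bounds (P := P) (γ := γ) (p := p) (y := y) hα hαβ t j
  have h0 : 0 ≤ 1 / (iterate P γ α β p y t).omega j ^ 2 := by positivity
  rw [deviationInput, div_eq_mul_one_div, abs_mul, abs_of_nonneg h0]
  refine (mul_le_mul_of_nonneg_left h.2 (abs_nonneg _)).trans ?_
  exact Finset.single_le_sum (f := fun i => |σ * (y i - τ)| * (1 / α ^ 2))
    (fun i _ => by positivity) (Finset.mem_univ j)

theorem theta_sub_eq {σ τ : ℝ} {t : ℕ} {i : V}
    (hν : 0 < (iterate P γ α β p y t).nu i) :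
    σ * ((iterate P γ α β p y t).theta i - τ) =
      deviation P γ α β p y σ τ t i / (iterate P γ α β p y t).nu i := by
  rw [State.theta, deviation]
  field_simp

theorem tendsto_theta_of_deviation {F : Filter ℕ} (hF : F ≤ atTop) {σ τ c : ℝ} (hσ : σ * σ = 1)
    (hc : 0 < c) (hν : ∀ᶠ t in atTop, ∀ i, c ≤ (iterate P γ α β p y t).nu i) {i : V}
    (h : Tendsto (fun t => deviation P γ α β p y σ τ t i) F (𝓝 0)) :
    Tendsto (fun t => (iterate P γ α β p y t).theta i) F (𝓝 τ) := by
  have h1 : Tendsto (fun t => deviation P γ α β p y σ τ t i / (iterate P γ α β p y t).nu i) F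
      (𝓝 0) := by
    refine squeeze_zero_norm' (a := fun t => |deviation P γ α β p y σ τ t i| / c) ?_
      (by simpa using h.abs.div_const c)
    filter_upwards [hF hν] with t ht
    have := ht i
    rw [Real.norm_eq_abs, abs_div, abs_of_pos (hc.trans_le this)]
    gcongr
  have h2 : Tendsto (fun t => (iterate P γ α β p y t).theta i - τ) F (𝓝 0) := by
    have h3 := h1.const_mul σ
    rw [mul_zero] at h3
    refine h3.congr' ?_
    filter_upwards [hF hν] with t ht
    rw [← theta_sub_eq (hc.trans_le (ht i)), ← mul_assoc, hσ, one_mul]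
  simpa using h2.add_const τ

variable [Nonempty V] {lam : V → ℝ} {v : V → V → ℝ}

/-- Every input of ν is at least 1/β², so the mean eventually exceeds two thirds of it, and
consensus costs the nodes at most another third. -/
theorem exists_nu_lower_bound (hv : IsConsensusBasis P lam v) (hcol : ∀ j, ∑ i, P i j = 1)
    (hγ : IsStepSize γ) (hα : 0 < α) (hαβ : α < β) :
    ∃ c > 0, ∀ᶠ t in atTop, ∀ i, c ≤ (iterate P γ α β p y t).nu i := by
  have hβ := hα.trans hαβ
  set s := iterate P γ α β p y with hs
  set c := 1 / β ^ 2 with hc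
  have hc0 : 0 < c := by positivity
  have hb := inv_sq_omega_bounds (P := P) (γ := γ) (p := p) (y := y) hα hαβ
  refine ⟨c / 3, by positivity, ?_⟩
  have hmean := mean_bounded (m := fun t => -(s t).nu)
    (r := fun t => -(fun i => 1 / (s t).omega i ^ 2)) (B := -c) hcol hγ
    (fun t => by
      simp only [hs, nu_succ]; ext i; simp [averageStep]; ring)
    (Eventually.of_forall fun t j => neg_le_neg (hb t j).1) (show 0 < c / 3 by positivity)
  have hdev : ∀ᶠ t in atTop, ∀ i, -(c / 3) ≤ (s t).nu i - mean (s t).nu := by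
    rw [eventually_all]
    intro i
    refine (tendsto_sub_mean (m := fun t => (s t).nu)
      (r := fun t i => 1 / (s t).omega i ^ 2) (B := 1 / α ^ 2) hv hγ nu_succ
      (Eventually.of_forall fun t j => ?_) i).eventually_const_le (by linarith)
    rw [abs_of_nonneg (by positivity)]
    exact (hb t j).2
  filter_upwards [hmean, hdev] with t h1 h2 i
  have hneg : mean (-(s t).nu) = -mean (s t).nu := by simp [mean, neg_div]
  rw [hneg] at h1
  linarith [h2 i]

/-- If the deviation of one node vanishes along `F`, then at every fixed lag the estimates of all
nodes tend to the level `τ` along `F`. -/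
theorem tendsto_theta_lag (hv : IsConsensusBasis P lam v) (hcol : ∀ j, ∑ i, P i j = 1)
    (hγ : IsStepSize γ) (hα : 0 < α) (hαβ : α < β) {F : Filter ℕ} (hF : F ≤ atTop) {σ τ : ℝ}
    (hσ : σ * σ = 1) {i : V}
    (h : Tendsto (fun t => deviation P γ α β p y σ τ t i) F (𝓝 0)) (k : ℕ) (j : V) :
    Tendsto (fun t => (iterate P γ α β p y (t - k)).theta j) F (𝓝 τ) := by
  obtain ⟨B, hB⟩ := deviationInput_bounded (P := P) (γ := γ) (p := p) (y := y) hα hαβ σ τ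
  obtain ⟨c, hc, hν⟩ := exists_nu_lower_bound (p := p) (y := y) hv hcol hγ hα hαβ
  have hB' : ∀ᶠ t in atTop, ∀ j, |deviationInput P γ α β p y σ τ t j| ≤ B :=
    Eventually.of_forall hB
  have hlag : ∀ k : ℕ, Tendsto (fun t : ℕ => t - k) F atTop := fun k =>
    (tendsto_sub_atTop_nat k).mono_left hF
  have hi : ∀ k : ℕ, Tendsto (fun t => deviation P γ α β p y σ τ (t - k) i) F (𝓝 0) := by
    intro k
    induction k with
    | zero => exact h
    | succ k ih =>
      -- Going one step further into the past changes the deviation by a vanishing increment.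
      have hinc := (tendsto_increment hv hcol hγ (deviation_succ σ τ) hB' i).comp (hlag (k + 1))
      have := ih.sub hinc
      rw [sub_zero] at this
      refine this.congr' ?_
      filter_upwards [hF (eventually_ge_atTop (k + 1))] with t ht
      have : t - (k + 1) + 1 = t - k := by omega
      simp only [Function.comp_apply, this]
      ring
  have hj : Tendsto (fun t => deviation P γ α β p y σ τ (t - k) j) F (𝓝 0) := by
    have h1 := (tendsto_sub_mean hv hγ (deviation_succ σ τ) hB' i).comp (hlag k)
    have h2 := (tendsto_sub_mean hv hγ (deviation_succ σ τ) hB' j).comp (hlag k)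
    have := ((hi k).sub h1).add h2
    simp only [sub_zero, add_zero] at this
    exact this.congr fun t => by simp only [Function.comp_apply]; ring
  exact tendsto_theta_of_deviation (F := F.map fun t => t - k) (hlag k) hσ hc hν
    (tendsto_map'_iff.2 hj)

theorem eventually_omega_lag (hv : IsConsensusBasis P lam v) (hcol : ∀ j, ∑ i, P i j = 1)
    (hγ : IsStepSize γ) (hα : 0 < α) (hαβ : α < β) {F : Filter ℕ} (hF : F ≤ atTop) {σ τ : ℝ}
    (hσ : σ * σ = 1) {i : V} (hgen : ∀ j, j ≠ i → |y j - τ| ≠ delta α β p)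
    (h : Tendsto (fun t => deviation P γ α β p y σ τ t i) F (𝓝 0)) (k : ℕ) :
    ∀ᶠ t in F, ∀ j, j ≠ i →
      (iterate P γ α β p y (t - k)).omega j = classify α β p (y j) τ := by
  rw [eventually_all]
  intro j
  by_cases hj : j = i
  · simp [hj]
  -- Requiring `t ≥ k + 1` keeps `t - k` positive: the initial `omega` is not the classification of
  -- an estimate.
  filter_upwards [(tendsto_theta_lag hv hcol hγ hα hαβ hF hσ h k j).eventually
    (eventually_classify_eq fun _ => hgen j hj), hF (eventually_ge_atTop (k + 1))] with t h1 h2 _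
  rw [iterate_omega_eq (by omega), h1]

/-- Every node is eventually on one side of each of its two thresholds. -/
theorem eventually_side (hv : IsConsensusBasis P lam v) (hcol : ∀ j, ∑ i, P i j = 1)
    (hγ : IsStepSize γ) (hα : 0 < α) (hαβ : α < β) (hδ : 0 < delta α β p) {σ : ℝ}
    (hσ : σ * σ = 1) {i : V}
    (hgen : ∀ j, j ≠ i → |y j - (y i + σ * delta α β p)| ≠ delta α β p) :
    (∀ᶠ t in atTop, 0 ≤ deviation P γ α β p y σ (y i + σ * delta α β p) t i) ∨
      ∀ᶠ t in atTop, ¬ 0 ≤ deviation P γ α β p y σ (y i + σ * delta α β p) t i := by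
  classical
  have hβ := hα.trans hαβ
  set δ := delta α β p with hδdef
  set τ := y i + σ * δ with hτ
  set n := deviation P γ α β p y σ τ with hn
  set r := deviationInput P γ α β p y σ τ with hr
  set s := iterate P γ α β p y with hs
  obtain ⟨B, hB⟩ := deviationInput_bounded (P := P) (γ := γ) (p := p) (y := y) hα hαβ σ τ
  obtain ⟨c, hc, hν⟩ := exists_nu_lower_bound (p := p) (y := y) hv hcol hγ hα hαβ
  have hB' : ∀ᶠ t in atTop, ∀ j, |r t j| ≤ B := Eventually.of_forall hB
  have hσi : σ * (y i - τ) = -δ := by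
    rw [hτ]; linear_combination (-δ) * hσ
  have hri : ∀ t, r t i = -δ / (s t).omega i ^ 2 := fun t => by
    rw [hr, deviationInput, hσi]
  have habs : ∀ x : ℝ, |σ * x| = |x| := fun x => by
    have : |σ| = 1 := by
      have h := abs_mul_abs_self σ
      rw [hσ] at h
      nlinarith [abs_nonneg σ]
    rw [abs_mul, this, one_mul]
  have hdist : ∀ t, 0 < (s t).nu i → |y i - (s t).theta i| = |δ + n t i / (s t).nu i| := by
    intro t ht
    rw [← habs, ← abs_neg, ← theta_sub_eq ht]
    congr 1
    linear_combination -hσi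
  have hinc := tendsto_increment hv hcol hγ (deviation_succ σ τ) hB' i
  -- At a sign change the value is at most the increment, which vanishes.
  have hcross : ∀ F : Filter ℕ, F ≤ atTop → (∀ᶠ t in F, |n t i| ≤ |n (t + 1) i - n t i|) →
      Tendsto (fun t => n t i) F (𝓝 0) := fun F hF h =>
    squeeze_zero_norm' h (by simpa using (hinc.mono_left hF).abs)
  set rβ : V → ℝ := fun j =>
    if j = i then -δ / β ^ 2 else σ * (y j - τ) / classify α β p (y j) τ ^ 2 with hrβ
  set rα : V → ℝ := fun j =>
    if j = i then -δ / α ^ 2 else σ * (y j - τ) / classify α β p (y j) τ ^ 2 with hrα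
  have hmean : mean rα < mean rβ := by
    have hcard : (0 : ℝ) < Fintype.card V := by exact_mod_cast Fintype.card_pos
    refine div_lt_div_of_pos_right (Finset.sum_lt_sum (fun j _ => ?_) ⟨i, Finset.mem_univ i, ?_⟩)
      hcard
    · rw [hrα, hrβ]
      simp only
      split_ifs
      · rw [neg_div, neg_div]; gcongr
      · exact le_rfl
    · rw [hrα, hrβ]
      simp only [if_true, neg_div]
      gcongr
  rcases lt_or_ge 0 (mean rβ) with hpos | hneg
  · refine eventually_or_eventually_not ?_
    -- This is the filter of late downward crossings. Deriving `False` along it says that there are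
    -- finitely many; in that case the filter is trivial, so no subsequence has to be extracted.
    have hF : atTop ⊓ 𝓟 {t | 0 ≤ n t i ∧ n (t + 1) i < 0} ≤ atTop := inf_le_left
    have hmem : ∀ᶠ t in atTop ⊓ 𝓟 {t | 0 ≤ n t i ∧ n (t + 1) i < 0},
        0 ≤ n t i ∧ n (t + 1) i < 0 := mem_inf_of_right (mem_principal_self _)
    have hlim := hcross _ hF (hmem.mono fun t ht => by
      rw [abs_of_nonneg ht.1, abs_of_neg (by linarith)]; linarith)
    have hother := eventually_omega_lag hv hcol hγ hα hαβ hF hσ hgen hlim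
    have hlt := eventually_lt_succ hv hγ (deviation_succ σ τ) hB' hF hpos hlim
      (by
        filter_upwards [hmem, hF hν, hF (eventually_gt_atTop 0)] with t h1 h2 h3
        have hν' := hc.trans_le (h2 i)
        have : (s t).omega i = β := by
          rw [hs, iterate_omega_eq h3, classify, if_neg]
          rw [not_lt, hdist t hν']
          have := div_nonneg h1.1 hν'.le
          rw [abs_of_nonneg (by positivity)]
          linarith
        rw [← hr, hri, this, hrβ]; simp)
      -- The past classes of node `i` itself are unknown, but -δ/β² is the largest input it can
      -- receive, and a one-sided bound suffices.
      (fun k => Eventually.of_forall fun t => by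
        rw [← hr, hri, hrβ]
        simp only [if_true, neg_div, neg_le_neg_iff]
        have := (inv_sq_omega_bounds (P := P) (γ := γ) (p := p) (y := y) hα hαβ (t - k) i).1
        rw [div_eq_mul_one_div, div_eq_mul_one_div δ]
        exact mul_le_mul_of_nonneg_left this hδ.le)
      (fun k => (hother k).mono fun t ht j hj => by
        rw [deviationInput, ht j hj, hrβ]; simp [hj])
    have hfalse : ∀ᶠ t in atTop ⊓ 𝓟 {t | 0 ≤ n t i ∧ n (t + 1) i < 0}, False := by
      filter_upwards [hmem, hlt] with t h1 h2
      linarith [h1.1, h1.2]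
    rw [eventually_inf_principal] at hfalse
    exact hfalse.mono fun t ht h0 => not_lt.1 fun h1 => ht ⟨h0, h1⟩
  · have hpos : 0 < mean (-rα) := by
      have : mean (-rα) = -mean rα := by simp [mean, neg_div]
      linarith
    suffices h : ∀ᶠ t in atTop, ¬ 0 ≤ n t i → ¬ 0 ≤ n (t + 1) i by
      rcases eventually_or_eventually_not h with h | h
      · exact Or.inr h
      · exact Or.inl (h.mono fun t => not_not.1)
    have hF : atTop ⊓ 𝓟 {t | n t i < 0 ∧ 0 ≤ n (t + 1) i} ≤ atTop := inf_le_left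
    have hmem : ∀ᶠ t in atTop ⊓ 𝓟 {t | n t i < 0 ∧ 0 ≤ n (t + 1) i},
        n t i < 0 ∧ 0 ≤ n (t + 1) i := mem_inf_of_right (mem_principal_self _)
    have hlim := hcross _ hF (hmem.mono fun t ht => by
      rw [abs_of_neg ht.1, abs_of_nonneg (by linarith)]; linarith)
    have hother := eventually_omega_lag hv hcol hγ hα hαβ hF hσ hgen hlim
    have hlt := eventually_lt_succ (m := fun t => -n t) (r := fun t => -r t) hv hγ
      (fun t => by
        rw [hn, deviation_succ σ τ]; ext i; simp [averageStep, hr]; ring)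
      (hB'.mono fun t ht j => by simpa using ht j) hF hpos
      (by simpa using hlim.neg)
      (by
        -- Being below τ gives class α only if the estimate has not passed the opposite threshold of
        -- the node; closeness to τ ensures this.
        have hsmall : ∀ᶠ t in atTop ⊓ 𝓟 {t | n t i < 0 ∧ 0 ≤ n (t + 1) i}, -(δ * c) < n t i :=
          hlim.eventually_const_lt (by nlinarith)
        filter_upwards [hmem, hF hν, hF (eventually_gt_atTop 0), hsmall] with t h1 h2 h3 h4
        have hν' := hc.trans_le (h2 i)
        have : (s t).omega i = α := by
          rw [hs, iterate_omega_eq h3, classify, if_pos]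
          rw [hdist t hν']
          have h5 : n t i / (s t).nu i < 0 := div_neg_of_neg_of_pos h1.1 hν'
          have h6 : -δ < n t i / (s t).nu i := by
            rw [lt_div_iff₀ hν']
            nlinarith [h2 i]
          rw [abs_lt]
          constructor <;> linarith
        rw [Pi.neg_apply, hri, this, hrα]; simp)
      (fun k => Eventually.of_forall fun t => by
        rw [Pi.neg_apply, Pi.neg_apply, hri, hrα]
        simp only [if_true, neg_div, neg_neg]
        have := (inv_sq_omega_bounds (P := P) (γ := γ) (p := p) (y := y) hα hαβ (t - k) i).2
        rw [div_eq_mul_one_div, div_eq_mul_one_div δ]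
        exact mul_le_mul_of_nonneg_left this hδ.le)
      (fun k => (hother k).mono fun t ht j hj => by
        rw [Pi.neg_apply, Pi.neg_apply, hr, deviationInput, ht j hj, hrα]; simp [hj])
    have hfalse : ∀ᶠ t in atTop ⊓ 𝓟 {t | n t i < 0 ∧ 0 ≤ n (t + 1) i}, False := by
      filter_upwards [hmem, hlt] with t h1 h2
      simp only [Pi.neg_apply] at h2
      linarith [h1.1, h1.2]
    rw [eventually_inf_principal] at hfalse
    exact hfalse.mono fun t ht h0 h1 => ht ⟨not_le.1 h0, h1⟩

/-- Class α means lying strictly inside both thresholds (σ = 1 and σ = -1), and the side of each is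
eventually constant. For δ = 0 the class is β from time 1 on. -/
theorem exists_eventually_omega_eq (hv : IsConsensusBasis P lam v) (hcol : ∀ j, ∑ i, P i j = 1)
    (hγ : IsStepSize γ) (hα : 0 < α) (hαβ : α < β)
    (hgen : 0 < delta α β p → ∀ i j, j ≠ i → ∀ σ : ℝ, σ * σ = 1 →
      |y j - (y i + σ * delta α β p)| ≠ delta α β p) :
    ∃ w : V → ℝ, ∀ᶠ t in atTop, (iterate P γ α β p y t).omega = w := by
  suffices h : ∀ i, ∃ a, ∀ᶠ t in atTop, (iterate P γ α β p y t).omega i = a by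
    choose w hw using h
    exact ⟨w, (eventually_all.2 hw).mono fun t ht => funext ht⟩
  intro i
  rcases (delta_nonneg α β p).eq_or_lt with h0 | hδ
  · refine ⟨β, (eventually_gt_atTop 0).mono fun t ht => ?_⟩
    rw [iterate_omega_eq ht, classify_of_delta_eq_zero h0.symm]
  obtain ⟨c, hc, hν⟩ := exists_nu_lower_bound (p := p) (y := y) hv hcol hγ hα hαβ
  have hside : ∀ σ : ℝ, σ * σ = 1 →
      (∀ᶠ t in atTop, delta α β p ≤ -(σ * (y i - (iterate P γ α β p y t).theta i))) ∨
      ∀ᶠ t in atTop, -(σ * (y i - (iterate P γ α β p y t).theta i)) < delta α β p := by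
    intro σ hσ
    have hd : ∀ t, 0 < (iterate P γ α β p y t).nu i →
        -(σ * (y i - (iterate P γ α β p y t).theta i)) = delta α β p +
          deviation P γ α β p y σ (y i + σ * delta α β p) t i / (iterate P γ α β p y t).nu i := by
      intro t ht
      rw [← theta_sub_eq ht]
      linear_combination (delta α β p) * hσ
    rcases eventually_side hv hcol hγ hα hαβ hδ hσ (hgen hδ i · · σ hσ) with h | h
    · left
      filter_upwards [h, hν] with t h1 h2
      have hν' := hc.trans_le (h2 i)
      rw [hd t hν']
      linarith [div_nonneg h1 hν'.le]
    · right
      filter_upwards [h, hν] with t h1 h2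
      have hν' := hc.trans_le (h2 i)
      rw [hd t hν']
      linarith [div_neg_of_neg_of_pos (not_le.1 h1) hν']
  rcases hside 1 (by norm_num) with h1 | h1
  · refine ⟨β, ?_⟩
    filter_upwards [h1, eventually_gt_atTop 0] with t h1 ht
    rw [iterate_omega_eq ht, classify, if_neg]
    rw [not_lt]
    exact h1.trans (by rw [one_mul]; exact neg_le_abs _)
  · rcases hside (-1) (by norm_num) with h2 | h2
    · refine ⟨β, ?_⟩
      filter_upwards [h2, eventually_gt_atTop 0] with t h2 ht
      rw [iterate_omega_eq ht, classify, if_neg]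
      rw [not_lt]
      refine h2.trans (le_of_eq_of_le (by ring) (le_abs_self _))
    · refine ⟨α, ?_⟩
      filter_upwards [h1, h2, eventually_gt_atTop 0] with t h1 h2 ht
      rw [iterate_omega_eq ht, classify, if_pos]
      rw [abs_lt]
      constructor <;> linarith

theorem tendsto_theta (hv : IsConsensusBasis P lam v) (hcol : ∀ j, ∑ i, P i j = 1)
    (hγ : IsStepSize γ) (hα : 0 < α) (hαβ : α < β) {w : V → ℝ}
    (hw : ∀ᶠ t in atTop, (iterate P γ α β p y t).omega = w) (i : V) :
    Tendsto (fun t => (iterate P γ α β p y t).theta i) atTop (𝓝 (thetaHat y w)) := by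
  have hβ := hα.trans hαβ
  set c := thetaHat y w with hc
  obtain ⟨B, hB⟩ := deviationInput_bounded (P := P) (γ := γ) (p := p) (y := y) hα hαβ 1 c
  obtain ⟨c0, hc0, hν⟩ := exists_nu_lower_bound (p := p) (y := y) hv hcol hγ hα hαβ
  have hwmem : ∀ j, 0 < w j := by
    obtain ⟨t, ht⟩ := hw.exists
    intro j
    rw [← ht]
    rcases iterate_omega_mem (P := P) (γ := γ) (α := α) (β := β) (p := p) (y := y) t j with h | h
    all_goals rw [h]; assumption
  -- The weighted average is exactly the level at which the frozen inputs of the deviation have mean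
  -- zero.
  have hzero : ∑ j, 1 * (y j - c) / w j ^ 2 = 0 := by
    have hpos : 0 < ∑ j, 1 / w j ^ 2 :=
      Finset.sum_pos (fun j _ => by have := hwmem j; positivity) Finset.univ_nonempty
    have h1 : ∑ j, 1 * (y j - c) / w j ^ 2 = ∑ j, y j / w j ^ 2 - c * ∑ j, 1 / w j ^ 2 := by
      rw [Finset.mul_sum, ← Finset.sum_sub_distrib]
      exact Finset.sum_congr rfl fun j _ => by ring
    rw [h1, hc, thetaHat, div_mul_cancel₀ _ hpos.ne', sub_self]
  have hmean : Tendsto (fun t => mean (deviation P γ α β p y 1 c t)) atTop (𝓝 0) := by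
    refine tendsto_zero_of_relaxation (e := fun _ => 0) hγ.eventually_mem hγ.sum
      tendsto_const_nhds ?_
    filter_upwards [hw] with t ht
    rw [deviation_succ, mean_averageStep hcol]
    congr 2
    simp only [mean, deviationInput, ht, hzero, zero_div]
  have hdev := tendsto_sub_mean hv hγ (deviation_succ 1 c) (Eventually.of_forall hB) i
  refine tendsto_theta_of_deviation le_rfl (one_mul 1) hc0 hν ?_
  simpa using hdev.add hmean

end Algorithm

/-! ### The likelihood -/

section Likelihood

variable {V : Type*} [Fintype V] {α β p : ℝ} {y : V → ℝ}

open Classical in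
theorem logLikelihood_eq (hα : 0 < α) (hαβ : α < β) (hp : p ∈ Set.Ioo (0 : ℝ) 1) (θ : ℝ)
    {ω : V → ℝ} (hω : ∀ i, ω i = α ∨ ω i = β) :
    logLikelihood α p y θ ω = 1 / (Fintype.card V : ℝ) * ∑ i,
      (Real.log (if ω i = α then 1 - p else p) - Real.log (ω i) -
        Real.log (Real.sqrt (2 * Real.pi)) - (y i - θ) ^ 2 / (2 * ω i ^ 2)) := by
  have hω0 : ∀ i, 0 < ω i := fun i => by
    rcases hω i with h | h
    · rwa [h]
    · rw [h]; exact hα.trans hαβ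
  have hp0 : ∀ i, (0 : ℝ) < if ω i = α then 1 - p else p := fun i => by
    split_ifs
    · linarith [hp.2]
    · exact hp.1
  have hpi : 0 < Real.sqrt (2 * Real.pi) := by positivity
  rw [logLikelihood, jointDensity, Real.log_prod]
  · congr 1
    refine Finset.sum_congr rfl fun i _ => ?_
    have := hω0 i
    rw [condDensity, Real.log_mul (hp0 i).ne' (by positivity),
      Real.log_mul (by positivity) (Real.exp_pos _).ne', Real.log_exp, one_div, Real.log_inv,
      Real.log_mul this.ne' hpi.ne']
    ring
  · intro i _
    have := hω0 i
    have := hp0 i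
    rw [condDensity]
    positivity

theorem logLikelihood_lt_thetaHat [Nonempty V] (hα : 0 < α) (hαβ : α < β)
    (hp : p ∈ Set.Ioo (0 : ℝ) 1) {ω : V → ℝ} (hω : ∀ i, ω i = α ∨ ω i = β) {θ : ℝ}
    (hθ : θ ≠ thetaHat y ω) :
    logLikelihood α p y θ ω < logLikelihood α p y (thetaHat y ω) ω := by
  classical
  have hcard : (0 : ℝ) < Fintype.card V := by exact_mod_cast Fintype.card_pos
  have hω0 : ∀ i, 0 < ω i := fun i => by
    rcases hω i with h | h
    · rwa [h]
    · rw [h]; exact hα.trans hαβ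
  have hS : 0 < ∑ j, 1 / ω j ^ 2 :=
    Finset.sum_pos (fun j _ => by have := hω0 j; positivity) Finset.univ_nonempty
  rw [logLikelihood_eq hα hαβ hp _ hω, logLikelihood_eq hα hαβ hp _ hω]
  refine mul_lt_mul_of_pos_left ?_ (by positivity)
  rw [Finset.sum_sub_distrib, Finset.sum_sub_distrib (f := fun i => _ - _ - _)]
  refine sub_lt_sub_left ?_ _
  set c := thetaHat y ω with hc
  have hcS : c * ∑ j, 1 / ω j ^ 2 = ∑ j, y j / ω j ^ 2 := by
    rw [hc, thetaHat, div_mul_cancel₀ _ hS.ne']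
  -- Completing the square around the weighted average.
  have hdiff : ∑ i, (y i - θ) ^ 2 / (2 * ω i ^ 2) - ∑ i, (y i - c) ^ 2 / (2 * ω i ^ 2) =
      (θ - c) ^ 2 / 2 * ∑ j, 1 / ω j ^ 2 := by
    have h1 : ∑ i, (y i - θ) ^ 2 / (2 * ω i ^ 2) - ∑ i, (y i - c) ^ 2 / (2 * ω i ^ 2) =
        (c - θ) * ∑ j, y j / ω j ^ 2 + (θ ^ 2 - c ^ 2) / 2 * ∑ j, 1 / ω j ^ 2 := by
      rw [← Finset.sum_sub_distrib, Finset.mul_sum, Finset.mul_sum, ← Finset.sum_add_distrib]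
      refine Finset.sum_congr rfl fun i _ => ?_
      have := (hω0 i).ne'
      field_simp
      ring
    rw [h1, ← hcS]
    ring
  have hsq : 0 < (θ - c) ^ 2 := by
    have := sub_ne_zero.2 hθ
    positivity
  have : 0 < (θ - c) ^ 2 / 2 * ∑ j, 1 / ω j ^ 2 := by positivity
  linarith

/-- The classification with threshold `delta` maximizes the log-likelihood of one observation. -/
theorem le_logDensity_classify (hα : 0 < α) (hαβ : α < β) (hp : p ∈ Set.Ioo (0 : ℝ) 1)
    (z θ : ℝ) :
    (classify α β p z θ = α → Real.log p - Real.log β - (z - θ) ^ 2 / (2 * β ^ 2) ≤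
      Real.log (1 - p) - Real.log α - (z - θ) ^ 2 / (2 * α ^ 2)) ∧
    (classify α β p z θ = β → Real.log (1 - p) - Real.log α - (z - θ) ^ 2 / (2 * α ^ 2) ≤
      Real.log p - Real.log β - (z - θ) ^ 2 / (2 * β ^ 2)) := by
  have hβ := hα.trans hαβ
  have hp1 : 0 < 1 - p := by linarith [hp.2]
  have hp0 := hp.1
  set K := 1 / α ^ 2 - 1 / β ^ 2 with hK
  have hK0 : 0 < K := by
    rw [hK, sub_pos]
    gcongr
  have hlog : Real.log ((1 - p) / p * (β / α)) =
      Real.log (1 - p) - Real.log p + (Real.log β - Real.log α) := by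
    rw [Real.log_mul (by positivity) (by positivity), Real.log_div hp1.ne' hp0.ne',
      Real.log_div hβ.ne' hα.ne']
  set A := Real.log ((1 - p) / p * (β / α)) with hA
  have hδ : delta α β p = Real.sqrt (2 * A / K) := rfl
  have hquad : (z - θ) ^ 2 / (2 * α ^ 2) - (z - θ) ^ 2 / (2 * β ^ 2) = (z - θ) ^ 2 * K / 2 := by
    rw [hK]; ring
  constructor
  · intro h
    have hlt : |z - θ| < delta α β p := by
      by_contra hn
      rw [classify, if_neg hn] at h
      exact hαβ.ne' h
    -- This equivalence needs no sign of the radicand, so a negative logarithm requires no separate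
    -- case.
    rw [hδ, Real.lt_sqrt (abs_nonneg _), sq_abs, lt_div_iff₀ hK0] at hlt
    linarith
  · intro h
    have hge : delta α β p ≤ |z - θ| := by
      by_contra hn
      rw [classify, if_pos (not_le.1 hn)] at h
      exact hαβ.ne h
    rw [hδ, Real.sqrt_le_left (abs_nonneg _), sq_abs, div_le_iff₀ hK0] at hge
    linarith

theorem logLikelihood_le_omegaHat (hα : 0 < α) (hαβ : α < β) (hp : p ∈ Set.Ioo (0 : ℝ) 1)
    {ω : V → ℝ} (hω : ∀ i, ω i = α ∨ ω i = β) (θ : ℝ) :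
    logLikelihood α p y θ ω ≤ logLikelihood α p y θ (omegaHat α β p y θ) := by
  classical
  rw [logLikelihood_eq hα hαβ hp _ hω,
    logLikelihood_eq hα hαβ hp θ (ω := omegaHat α β p y θ) fun i => classify_mem α β p (y i) θ]
  refine mul_le_mul_of_nonneg_left (Finset.sum_le_sum fun i _ => ?_) (by positivity)
  have h := le_logDensity_classify hα hαβ hp (y i) θ
  have hmem : omegaHat α β p y θ i = α ∨ omegaHat α β p y θ i = β := classify_mem ..
  rcases hω i with h1 | h1 <;> rcases hmem with h2 | h2 <;>
    simp only [h1, h2, if_true, hαβ.ne', if_false, le_refl]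
  · linarith [h.2 h2]
  · linarith [h.1 h2]

end Likelihood

/-! ### Genericity and measurability -/

section Probability

variable {V Ω : Type*} [Fintype V] [MeasurableSpace Ω] {Pr : Measure Ω}

/-- An atomless random variable almost surely differs from an independent one. -/
theorem ae_ne_of_indepFun [IsProbabilityMeasure Pr] {X Z : Ω → ℝ} (hX : Measurable X)
    (hZ : Measurable Z) (h : IndepFun X Z Pr) (hatom : ∀ a, Measure.map X Pr {a} = 0) :
    ∀ᵐ x ∂Pr, X x ≠ Z x := by
  have hprod := (indepFun_iff_map_prod_eq_prod_map_map hX.aemeasurable hZ.aemeasurable).1 h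
  have hS : MeasurableSet {q : ℝ × ℝ | q.1 = q.2} :=
    measurableSet_eq_fun measurable_fst measurable_snd
  have : IsProbabilityMeasure (Measure.map X Pr) := Measure.isProbabilityMeasure_map hX.aemeasurable
  have : IsProbabilityMeasure (Measure.map Z Pr) := Measure.isProbabilityMeasure_map hZ.aemeasurable
  have h0 : ((Measure.map X Pr).prod (Measure.map Z Pr)) {q : ℝ × ℝ | q.1 = q.2} = 0 := by
    rw [Measure.prod_apply_symm hS]
    simp only [Set.preimage_ofPred_eq, Set.ofPred_eq_eq_singleton, hatom, lintegral_zero]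
  rw [← hprod, Measure.map_apply (hX.prodMk hZ) hS] at h0
  rw [ae_iff]
  simpa using h0

variable {θstar α β p : ℝ} {W η : V → Ω → ℝ}

theorem measurable_observation {ι : Type*} {W η : ι → Ω → ℝ} (hW : ∀ i, Measurable (W i))
    (hη : ∀ i, Measurable (η i)) (i : ι) :
    Measurable fun x => observation θstar W η x i :=
  ((hW i).mul (hη i)).const_add θstar

/-- Solved for η_k, equality would force this atomless variable to equal a function of all the other
variables, from which it is independent; dividing by `c k * W k` is legitimate almost surely. -/
theorem ae_linear_combination_ne [IsProbabilityMeasure Pr] (hW : ∀ i, Measurable (W i))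
    (hη : ∀ i, Measurable (η i)) (hWne : ∀ i, ∀ᵐ x ∂Pr, W i x ≠ 0)
    (hηlaw : ∀ i, Measure.map (η i) Pr = gaussianReal 0 1)
    (hindep : iIndepFun (Sum.elim W η) Pr) {c : V → ℝ} {k : V} (hk : c k ≠ 0) (d : ℝ) :
    ∀ᵐ x ∂Pr, ∑ j, c j * observation θstar W η x j ≠ d := by
  classical
  set S : Finset (V ⊕ V) := {Sum.inr k} with hS
  set T : Finset (V ⊕ V) := Finset.univ.erase (Sum.inr k) with hT
  have hkT : ∀ j, Sum.inl j ∈ T := fun j => by simp [hT]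
  have hjT : ∀ j, j ≠ k → Sum.inr j ∈ T := fun j hj => by simp [hT, hj]
  have hdisj : Disjoint S T := by
    rw [hS, Finset.disjoint_singleton_left, hT]
    exact Finset.notMem_erase _ _
  have hmeas : ∀ i, Measurable (Sum.elim W η i) := by
    rintro (i | i)
    · exact hW i
    · exact hη i
  have hind := hindep.indepFun_finset S T hdisj hmeas
  set f : (S → ℝ) → ℝ := fun u => u ⟨Sum.inr k, Finset.mem_singleton_self _⟩ with hf
  set g : (T → ℝ) → ℝ := fun u => ((d - c k * θstar - ∑ j,
    if h : j ≠ k then c j * (θstar + u ⟨Sum.inl j, hkT j⟩ * u ⟨Sum.inr j, hjT j h⟩) else 0) /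
      (c k * u ⟨Sum.inl k, hkT k⟩)) with hg
  have hfm : Measurable f := by rw [hf]; fun_prop
  have hgm : Measurable g := by
    refine Measurable.div (measurable_const.sub (Finset.measurable_sum _ fun j _ => ?_))
      (by fun_prop)
    split_ifs with h <;> fun_prop
  have hfg := hind.comp hfm hgm
  have htup : Measurable fun x (i : T) => Sum.elim W η i x :=
    measurable_pi_lambda _ fun i => hmeas i
  have hne := ae_ne_of_indepFun (X := η k) (hη k) (hgm.comp htup) hfg (fun a => by
    rw [hηlaw]
    have := nullSingletonClass_gaussianReal (μ := 0) (v := 1) one_ne_zero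
    exact measure_singleton a)
  filter_upwards [hne, hWne k] with x h1 h2 h3
  apply h1
  simp only [Function.comp_apply, hg, Sum.elim_inl, Sum.elim_inr]
  rw [eq_div_iff (mul_ne_zero hk h2), ← h3,
    ← Finset.add_sum_erase _ _ (Finset.mem_univ k)]
  have hsum : (∑ j, if h : j ≠ k then c j * (θstar + W j x * η j x) else 0) =
      ∑ j ∈ Finset.univ.erase k, c j * observation θstar W η x j := by
    rw [← Finset.add_sum_erase _ _ (Finset.mem_univ k), dif_neg (not_not.2 rfl), zero_add]
    refine Finset.sum_congr rfl fun j hj => ?_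
    rw [dif_pos (Finset.ne_of_mem_erase hj), observation]
  rw [hsum, observation]
  ring

theorem ae_ne_zero_of_bernoulli {X : Ω → ℝ} (hX : Measurable X) (hα : α ≠ 0) (hβ : β ≠ 0)
    {q : unitInterval} (hlaw : Measure.map X Pr = bernoulliMeasure β α q) :
    ∀ᵐ x ∂Pr, X x ≠ 0 := by
  have h : Measure.map X Pr {0} = 0 := by
    rw [hlaw, bernoulliMeasure_def]
    simp [hα, hβ]
  rw [Measure.map_apply hX (measurableSet_singleton 0)] at h
  rw [ae_iff]
  simp only [not_not]
  exact h

theorem measurable_classify {z θ : Ω → ℝ} (hz : Measurable z) (hθ : Measurable θ) :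
    Measurable fun x => classify α β p (z x) (θ x) := by
  unfold classify
  refine Measurable.ite (measurableSet_lt ?_ measurable_const) measurable_const measurable_const
  exact (hz.sub hθ).abs

theorem measurable_iterate {P : Matrix V V ℝ} {γ : ℕ → ℝ} {y : Ω → V → ℝ}
    (hy : ∀ i, Measurable fun x => y x i) (t : ℕ) :
    (∀ i, Measurable fun x => (iterate P γ α β p (y x) t).mu i) ∧
    (∀ i, Measurable fun x => (iterate P γ α β p (y x) t).nu i) ∧
    ∀ i, Measurable fun x => (iterate P γ α β p (y x) t).omega i := by
  induction t with
  | zero => exact ⟨fun i => measurable_const, fun i => measurable_const, fun i => measurable_const⟩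
  | succ t ih =>
    obtain ⟨h1, h2, h3⟩ := ih
    have hmu : ∀ i, Measurable fun x => (iterate P γ α β p (y x) (t + 1)).mu i := fun i =>
      ((Finset.measurable_sum _ fun j _ => (h1 j).const_mul _).const_mul _).add
        (((hy i).div ((h3 i).pow_const 2)).const_mul _)
    have hnu : ∀ i, Measurable fun x => (iterate P γ α β p (y x) (t + 1)).nu i := fun i =>
      ((Finset.measurable_sum _ fun j _ => (h2 j).const_mul _).const_mul _).add
        ((measurable_const.div ((h3 i).pow_const 2)).const_mul _)
    exact ⟨hmu, hnu, fun i => measurable_classify (hy i) ((hmu i).div (hnu i))⟩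

theorem measurable_thetaHat {y ω : Ω → V → ℝ} (hy : ∀ i, Measurable fun x => y x i)
    (hω : ∀ i, Measurable fun x => ω x i) : Measurable fun x => thetaHat (y x) (ω x) :=
  (Finset.measurable_sum _ fun j _ => (hy j).div ((hω j).pow_const 2)).div
    (Finset.measurable_sum _ fun j _ => measurable_const.div ((hω j).pow_const 2))

end Probability

section Generic

variable {V Ω : Type*} [Fintype V] [MeasurableSpace Ω] {Pr : Measure Ω}
  [IsProbabilityMeasure Pr] {θstar α β p : ℝ} {W η : V → Ω → ℝ}

/-- Almost surely, the thresholds of different nodes are different. -/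
theorem ae_threshold_ne (hW : ∀ i, Measurable (W i))
    (hη : ∀ i, Measurable (η i)) (hWne : ∀ i, ∀ᵐ x ∂Pr, W i x ≠ 0)
    (hηlaw : ∀ i, Measure.map (η i) Pr = gaussianReal 0 1)
    (hindep : iIndepFun (Sum.elim W η) Pr) (δ : ℝ) :
    ∀ᵐ x ∂Pr, ∀ i j, j ≠ i → ∀ σ : ℝ, σ * σ = 1 →
      |observation θstar W η x j - (observation θstar W η x i + σ * δ)| ≠ δ := by
  classical
  have key : ∀ i j, j ≠ i → ∀ d : ℝ,
      ∀ᵐ x ∂Pr, observation θstar W η x j - observation θstar W η x i ≠ d := by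
    intro i j hij d
    have h := ae_linear_combination_ne (θstar := θstar) hW hη hWne hηlaw hindep
      (c := fun k => (if k = j then 1 else 0) - (if k = i then 1 else 0)) (k := j)
      (by simp [hij]) d
    filter_upwards [h] with x hx
    simpa [sub_mul, Finset.sum_sub_distrib] using hx
  rw [ae_all_iff]; intro i
  rw [ae_all_iff]; intro j
  by_cases hij : j = i
  · simp [hij]
  -- The intervals of half-width δ around two observations share an endpoint only if their centres
  -- differ by 0 or ±2δ.
  filter_upwards [key i j hij 0, key i j hij (2 * δ), key i j hij (-(2 * δ))] with x h0 h1 h2 _ σ hσ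
  intro habs
  rcases mul_self_eq_one_iff.1 hσ with rfl | rfl <;>
    rcases eq_or_eq_neg_of_abs_eq habs with h | h
  · exact h1 (by linarith)
  · exact h0 (by linarith)
  · exact h0 (by linarith)
  · exact h2 (by linarith)

/-- Almost surely, no weighted average `thetaHat y w` lies on a threshold. -/
theorem ae_thetaHat_ne_threshold (hW : ∀ i, Measurable (W i))
    (hη : ∀ i, Measurable (η i)) (hWne : ∀ i, ∀ᵐ x ∂Pr, W i x ≠ 0)
    (hηlaw : ∀ i, Measure.map (η i) Pr = gaussianReal 0 1)
    (hindep : iIndepFun (Sum.elim W η) Pr) (hα : 0 < α) (hβ : 0 < β) {δ : ℝ} (hδ : 0 < δ) :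
    ∀ᵐ x ∂Pr, ∀ w : V → ℝ, (∀ i, w i = α ∨ w i = β) → ∀ i,
      |observation θstar W η x i - thetaHat (observation θstar W η x) w| ≠ δ := by
  classical
  have key : ∀ w : V → ℝ, (∀ i, 0 < w i) → ∀ i, ∀ d : ℝ, d ≠ 0 →
      ∀ᵐ x ∂Pr, observation θstar W η x i - thetaHat (observation θstar W η x) w ≠ d := by
    intro w hw i d hd
    set S := ∑ j, 1 / w j ^ 2 with hS
    set c : V → ℝ := fun k => (if k = i then 1 else 0) - 1 / w k ^ 2 / S with hc
    have hcomb : ∀ x, ∑ k, c k * observation θstar W η x k =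
        observation θstar W η x i - thetaHat (observation θstar W η x) w := by
      intro x
      simp only [hc, sub_mul, Finset.sum_sub_distrib, ite_mul, one_mul, zero_mul,
        Finset.sum_ite_eq', Finset.mem_univ, if_true, thetaHat, ← hS, Finset.sum_div]
      congr 1
      exact Finset.sum_congr rfl fun k _ => by ring
    by_cases hk : ∃ k, c k ≠ 0
    · obtain ⟨k, hk⟩ := hk
      filter_upwards [ae_linear_combination_ne (θstar := θstar) hW hη hWne hηlaw hindep hk d]
        with x hx
      rwa [← hcomb]
    -- If all coefficients vanish, as for a single node, the combination is identically 0 and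
    -- differs from `d` because `d ≠ 0`; hence the requirement δ > 0.
    · push Not at hk
      refine Eventually.of_forall fun x => ?_
      rw [← hcomb]
      simpa [hk] using hd.symm
  -- Indexing the classifications by Boolean vectors makes the family finite, so that the null sets
  -- can be united.
  have hfin : ∀ B : V → Bool, ∀ᵐ x ∂Pr, ∀ i,
      |observation θstar W η x i - thetaHat (observation θstar W η x)
        (fun j => if B j then α else β)| ≠ δ := by
    intro B
    rw [ae_all_iff]
    intro i
    have hw : ∀ j, (0 : ℝ) < if B j then α else β := fun j => by split_ifs <;> assumption
    filter_upwards [key _ hw i δ hδ.ne', key _ hw i (-δ) (neg_ne_zero.2 hδ.ne')] with x h1 h2 habs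
    rcases eq_or_eq_neg_of_abs_eq habs with h | h
    · exact h1 h
    · exact h2 h
  filter_upwards [ae_all_iff.2 hfin] with x hx w hw
  have hwB : w = fun j => if (decide (w j = α) : Bool) then α else β := by
    ext j
    by_cases h : w j = α
    · simp [h]
    · simpa [h] using (hw j).resolve_left h
  rw [hwB]
  exact hx _

end Generic

/-! ### The limit classification as a measurable function of the data -/

open Classical in
/-- The limit classification: `α` at the nodes that are eventually classified as `α`. -/
noncomputable def limitOmega {V : Type*} [Fintype V] (P : Matrix V V ℝ) (γ : ℕ → ℝ) (α β p : ℝ)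
    (y : V → ℝ) (i : V) : ℝ :=
  if ∀ᶠ t in atTop, (iterate P γ α β p y t).omega i = α then α else β

theorem limitOmega_mem {V : Type*} [Fintype V] (P : Matrix V V ℝ) (γ : ℕ → ℝ) (α β p : ℝ)
    (y : V → ℝ) (i : V) : limitOmega P γ α β p y i = α ∨ limitOmega P γ α β p y i = β := by
  unfold limitOmega
  split_ifs <;> simp

theorem measurable_limitOmega {V Ω : Type*} [Fintype V] [MeasurableSpace Ω] {P : Matrix V V ℝ}
    {γ : ℕ → ℝ} {α β p : ℝ} {y : Ω → V → ℝ} (hy : ∀ i, Measurable fun x => y x i) (i : V) :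
    Measurable fun x => limitOmega P γ α β p (y x) i := by
  unfold limitOmega
  refine Measurable.ite ?_ measurable_const measurable_const
  simp only [eventually_atTop]
  have : {x | ∃ T, ∀ t ≥ T, (iterate P γ α β p (y x) t).omega i = α} =
      ⋃ T : ℕ, ⋂ t : ℕ, ⋂ _ : t ≥ T, {x | (iterate P γ α β p (y x) t).omega i = α} := by
    ext x; simp
  rw [this]
  exact MeasurableSet.iUnion fun T => MeasurableSet.iInter fun t => MeasurableSet.iInter fun _ =>
    measurableSet_eq_fun ((measurable_iterate hy t).2.2 i) measurable_const

theorem eventually_omega_eq_limitOmega {V : Type*} [Fintype V] {P : Matrix V V ℝ} {γ : ℕ → ℝ}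
    {α β p : ℝ} {y w : V → ℝ} (hw : ∀ᶠ t in atTop, (iterate P γ α β p y t).omega = w) :
    ∀ᶠ t in atTop, (iterate P γ α β p y t).omega = limitOmega P γ α β p y := by
  suffices h : w = limitOmega P γ α β p y by rwa [← h]
  ext i
  rw [limitOmega]
  split_ifs with h
  · obtain ⟨t, h1, h2⟩ := (hw.and h).exists
    rw [← h1, h2]
  · obtain ⟨t, ht⟩ := hw.exists
    rcases iterate_omega_mem (P := P) (γ := γ) (α := α) (β := β) (p := p) (y := y) t i with h1 | h1
    · refine absurd (hw.mono fun u hu => ?_) h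
      rw [hu, ← ht, h1]
    · rw [← ht, h1]

end InputDrivenConsensus

/-! ### Convergence and optimality of the limit -/

open InputDrivenConsensus in
theorem theorem1
    {V : Type*} [Fintype V] [DecidableEq V] [Nonempty V]
    {Ω : Type*} [MeasurableSpace Ω] (Pr : Measure Ω) [IsProbabilityMeasure Pr]
    (θstar α β p : ℝ) (hα : 0 < α) (hαβ : α < β) (hp : p ∈ Set.Ioo (0 : ℝ) 1)
    -- the random data: types `W i`, noises `η i`, all independent
    (W η : V → Ω → ℝ) (hW : ∀ i, Measurable (W i)) (hη : ∀ i, Measurable (η i))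
    (hWlaw : ∀ i, Measure.map (W i) Pr = bernoulliMeasure β α ⟨p, hp.1.le, hp.2.le⟩)
    (hηlaw : ∀ i, Measure.map (η i) Pr = gaussianReal 0 1)
    (hindep : iIndepFun (Sum.elim W η) Pr)
    -- the step sizes
    (γ : ℕ → ℝ) (hγ0 : Tendsto γ atTop (𝓝 0))
    (hγ1 : ∀ᶠ t : ℕ in atTop, 1 / (t : ℝ) ≤ γ t)
    (hγ2 : (fun t => γ t - γ (t + 1)) =o[atTop] fun t => γ (t + 1))
    -- the consensus matrix
    (P : Matrix V V ℝ) (hPstoch : P ∈ Matrix.rowStochastic ℝ V) (hPsymm : P.IsSymm)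
    (hPprim : P.IsPrimitive)
    (hPeig : ∀ l : ℝ, Module.End.HasEigenvalue (Matrix.toLin' P) l → 0 < l) :
    ∃ (ωIA : Ω → V → ℝ) (θIA : Ω → ℝ), Measurable ωIA ∧ Measurable θIA ∧
      (∀ x i, ωIA x i = α ∨ ωIA x i = β) ∧
      ∀ᵐ x ∂Pr,
        let y : V → ℝ := InputDrivenConsensus.observation θstar W η x
        let s : ℕ → InputDrivenConsensus.State V :=
          InputDrivenConsensus.iterate P γ α β p y
        let L : ℝ → (V → ℝ) → ℝ := InputDrivenConsensus.logLikelihood α p y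
        -- the quotients defining the estimates are eventually genuine
        (∀ᶠ t in atTop, ∀ i, 0 < (s t).nu i) ∧
        -- convergence
        Tendsto (fun t => (s t).omega) atTop (𝓝 (ωIA x)) ∧
        (∀ i, Tendsto (fun t => (s t).theta i) atTop (𝓝 (θIA x))) ∧
        -- fixed point relations
        θIA x = InputDrivenConsensus.thetaHat y (ωIA x) ∧
        ωIA x = InputDrivenConsensus.omegaHat α β p y (θIA x) ∧
        -- the same relations as partial maximizations of the likelihood
        (∀ θ, θ ≠ θIA x → L θ (ωIA x) < L (θIA x) (ωIA x)) ∧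
        (∀ ω : V → ℝ, (∀ i, ω i = α ∨ ω i = β) → L (θIA x) ω ≤ L (θIA x) (ωIA x)) ∧
        -- local maximality
        IsLocalMax (fun θ => L θ (InputDrivenConsensus.omegaHat α β p y θ)) (θIA x) := by
  have hβ := hα.trans hαβ
  have hγ := isStepSize_of_le hγ0 hγ1 hγ2
  obtain ⟨lam, v, hv⟩ := exists_isConsensusBasis hPstoch hPsymm hPprim hPeig
  have hcol : ∀ j, ∑ i, P i j = 1 := fun j => by
    rw [← Matrix.sum_row_of_mem_rowStochastic hPstoch j]
    exact Finset.sum_congr rfl fun i _ => hPsymm.apply j i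
  have hy := fun i => measurable_observation (θstar := θstar) hW hη i
  have hωm : ∀ i, Measurable fun x => limitOmega P γ α β p (observation θstar W η x) i :=
    fun i => measurable_limitOmega hy i
  have hWne : ∀ i, ∀ᵐ x ∂Pr, W i x ≠ 0 := fun i =>
    ae_ne_zero_of_bernoulli (hW i) hα.ne' hβ.ne' (hWlaw i)
  have hgen := ae_threshold_ne (θstar := θstar) hW hη hWne hηlaw hindep (delta α β p)
  have hfix : ∀ᵐ x ∂Pr, 0 < delta α β p → ∀ w : V → ℝ, (∀ i, w i = α ∨ w i = β) → ∀ i,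
      |observation θstar W η x i - thetaHat (observation θstar W η x) w| ≠ delta α β p := by
    by_cases hδ : 0 < delta α β p
    · exact (ae_thetaHat_ne_threshold hW hη hWne hηlaw hindep hα hβ hδ).mono fun x hx _ => hx
    · exact Eventually.of_forall fun x h => absurd h hδ
  refine ⟨fun x => limitOmega P γ α β p (observation θstar W η x),
    fun x => thetaHat (observation θstar W η x)
      (limitOmega P γ α β p (observation θstar W η x)),
    measurable_pi_lambda _ hωm, measurable_thetaHat hy hωm,
    fun x i => limitOmega_mem P γ α β p _ i, ?_⟩
  filter_upwards [hgen, hfix] with x hgen hfix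
  intro y s L
  obtain ⟨w, hw⟩ := exists_eventually_omega_eq (y := y) hv hcol hγ hα hαβ fun _ => hgen
  have hωev := eventually_omega_eq_limitOmega hw
  clear hw w
  set w := limitOmega P γ α β p y with hwdef
  have hwmem : ∀ i, w i = α ∨ w i = β := limitOmega_mem P γ α β p y
  obtain ⟨c, hc, hν⟩ := exists_nu_lower_bound (p := p) (y := y) hv hcol hγ hα hαβ
  have hθlim := tendsto_theta hv hcol hγ hα hαβ hωev
  have hloc : ∀ i, ∀ᶠ θ in 𝓝 (thetaHat y w),
      classify α β p (y i) θ = classify α β p (y i) (thetaHat y w) := fun i =>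
    eventually_classify_eq fun hδ => hfix hδ w hwmem i
  have hfixω : w = omegaHat α β p y (thetaHat y w) := by
    ext i
    -- One late time is enough: there `omega` is already `w` and is the classification of an
    -- estimate so near the limit that it equals the classification at the limit.
    obtain ⟨t, h1, h2, h3⟩ :=
      (hωev.and (((hθlim i).eventually (hloc i)).and (eventually_gt_atTop 0))).exists
    rw [omegaHat, ← h2, ← h1, iterate_omega_eq h3]
  have hmaxθ : ∀ θ, θ ≠ thetaHat y w → L θ w < L (thetaHat y w) w := fun θ hθ =>
    logLikelihood_lt_thetaHat hα hαβ hp hwmem hθ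
  refine ⟨hν.mono fun t ht i => hc.trans_le (ht i), ?_, hθlim, rfl, hfixω, hmaxθ, ?_, ?_⟩
  · exact tendsto_const_nhds.congr' (hωev.mono fun t ht => ht.symm)
  · intro ω hω
    have h := logLikelihood_le_omegaHat (y := y) hα hαβ hp hω (thetaHat y w)
    rwa [← hfixω] at h
  · filter_upwards [eventually_all.2 hloc] with θ hθ
    have h1 : omegaHat α β p y θ = w := by
      rw [hfixω]
      exact funext hθ
    simp only [h1]
    rw [← hfixω]
    by_cases h : θ = thetaHat y w
    · rw [h]
    · exact (hmaxθ θ h).le
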